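/- Let $e_1,\dots,e_n$ be a basis of $\mathbb R^n$ and let $L=\mathbb Z e_1+\dots+\mathbb Z e_n$ be the lattice it generates. A lattice polytope is a convex polytope whose vertices all lie in $L$. A lattice-affine transformation is an invertible affine map $f$ of $\mathbb R^n$ with $f(L)=L$; two lattice polytopes are lattice-congruent if some lattice-affine transformation takes one to the other. A face of a polytope is its nonempty intersection with a supporting hyperplane; a face-flag of a $d$-dimensional polytope $P$ is a chain $P=F_d\supset F_{d-1}\supset\dots\supset F_0$ in which each $F_{i}$ ($i<d$) is an $i$-dimensional face of $F_{i+1}$. A lattice polytope is lattice-regular if for any two of its face-flags there is a lattice-affine transformation that preserves the polytope and takes the first flag to the second. It is elementary if it is not lattice-congruent to $tQ$ for any integer $t>1$ and any lattice polytope $Q$. An $n$-dimensional lattice cube is a set $\{p+\sum_{i=1}^n\alpha_i v_i : 0\le\alpha_i\le 1\}$ with $p\in L$ and linearly independent $v_1,\dots,v_n\in L$. The lattice volume of an $n$-dimensional polytope (lattice length if $n=1$) is its Euclidean volume divided by the minimal Euclidean volume of an $n$-dimensional simplex with vertices in $L$. Let $\{4,3^{n-2}\}^L_1$, $\{4,3^{n-2}\}^L_2$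 ($n\ge2$) and $\{4,3^{n-2}\}^L_3$ ($n\ge3$) be the lattice cubes with $p=0$ generated respectively by: $e_1,\dots,e_n$; $e_1,\dots,e_{n-1}$ and $e_1+\dots+e_{n-1}+2e_n$; $e_1$ and $e_1+2e_i$ for $i=2,\dots,n$. For $n=2$ the first two are written $\{4\}^L_1$ and $\{4\}^L_2$. Then: 1. If $n=1$, every elementary lattice-regular one-dimensional lattice cube is a lattice segment of lattice length $1$. 2. If $n=2$, every elementary lattice-regular two-dimensional lattice cube is lattice-congruent to $\{4\}^L_1$ or $\{4\}^L_2$. These two are lattice-regular and not lattice-congruent to each other. 3. If $n\ge3$, every elementary lattice-regular $n$-dimensional lattice cube is lattice-congruent to $\{4,3^{n-2}\}^L_1$, $\{4,3^{n-2}\}^L_2$ or $\{4,3^{n-2}\}^L_3$. These three cubes are lattice-regular, pairwise not lattice-congruent, and have lattice volumes $n!$, $2\cdot n!$ and $2^{n-1}\cdot n!$ respectively. -/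

import Mathlib

open scoped Pointwise

namespace LatticeGeometry

section Polytopes

variable {E : Type*} [NormedAddCommGroup E] [NormedSpace ℝ E]

/-- A convex polytope: the convex hull of a finite (nonempty) set of points. -/
def IsConvexPolytope (P : Set E) : Prop :=
  ∃ S : Finset E, S.Nonempty ∧ P = convexHull ℝ (S : Set E)

/-- A convex polytope is lattice if all its vertices are lattice points. -/
def IsLatticePolytope (L : Submodule ℤ E) (P : Set E) : Prop :=
  IsConvexPolytope P ∧ ∀ x ∈ P.extremePoints ℝ, x ∈ L

/-- An affine transformation is lattice-affine if it preserves the lattice. -/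
def IsLatticeAffine (L : Submodule ℤ E) (f : E ≃ᵃ[ℝ] E) : Prop :=
  f '' (L : Set E) = (L : Set E)

/-- Some lattice-affine transformation takes `P` to `Q`. -/
def LatticeCongruent (L : Submodule ℤ E) (P Q : Set E) : Prop :=
  ∃ f : E ≃ᵃ[ℝ] E, IsLatticeAffine L f ∧ f '' P = Q

/-- `F` is the (nonempty) intersection of `P` with the supporting hyperplane `{l = c}`. -/
def IsFace (P F : Set E) : Prop :=
  ∃ (l : E →ₗ[ℝ] ℝ) (c : ℝ), l ≠ 0 ∧ (∀ x ∈ P, l x ≤ c) ∧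
    F = {x ∈ P | l x = c} ∧ F.Nonempty

/-- The dimension of the affine span of a nonempty set. -/
noncomputable def dim (P : Set E) : ℕ :=
  Module.finrank ℝ (vectorSpan ℝ P)

/-- A face-flag of a `d`-dimensional polytope `P`, listed by increasing dimension: the whole
polytope, a hyperface of it, a hyperface of this hyperface, and so on down to a vertex.
The conditions force `d = dim P`. -/
structure IsFaceFlag (P : Set E) (d : ℕ) (F : Fin (d + 1) → Set E) : Prop where
  top : F (Fin.last d) = P
  dim_eq : ∀ i, dim (F i) = (i : ℕ)
  face : ∀ i : Fin d, IsFace (F i.succ) (F i.castSucc)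

/-- A lattice polytope is lattice-regular if lattice-affine transformations preserving it
act transitively on its face-flags. -/
def IsLatticeRegular (L : Submodule ℤ E) (P : Set E) : Prop :=
  IsLatticePolytope L P ∧
    ∀ (d : ℕ) (F G : Fin (d + 1) → Set E), IsFaceFlag P d F → IsFaceFlag P d G →
      ∃ f : E ≃ᵃ[ℝ] E, IsLatticeAffine L f ∧ f '' P = P ∧ ∀ i, f '' F i = G i

/-- A lattice polytope is elementary if it is not lattice-congruent to the `t`-multiple of a
lattice polytope for any integer `t > 1`. -/
def IsElementary (L : Submodule ℤ E) (P : Set E) : Prop :=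
  IsLatticePolytope L P ∧
    ∀ t : ℕ, 1 < t → ∀ Q : Set E, IsLatticePolytope L Q →
      ¬ LatticeCongruent L P ((t : ℝ) • Q)

end Polytopes

section Cubes

variable {n : ℕ}

/-- The lattice generated by a basis of `ℝⁿ`. -/
def lattice (e : Module.Basis (Fin n) ℝ (EuclideanSpace ℝ (Fin n))) :
    Submodule ℤ (EuclideanSpace ℝ (Fin n)) :=
  Submodule.span ℤ (Set.range e)

/-- An `n`-dimensional lattice cube in `ℝⁿ`: the set of all `p + ∑ αᵢ vᵢ` with `0 ≤ αᵢ ≤ 1`,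
for a lattice point `p` and linearly independent lattice vectors `v₁, …, vₙ`. -/
def IsLatticeCube (L : Submodule ℤ (EuclideanSpace ℝ (Fin n)))
    (C : Set (EuclideanSpace ℝ (Fin n))) : Prop :=
  ∃ p ∈ L, ∃ v : Fin n → EuclideanSpace ℝ (Fin n),
    (∀ i, v i ∈ L) ∧ LinearIndependent ℝ v ∧ C = p +ᵥ parallelepiped v

/-- The cube at the origin generated by `e₁, …, eₙ`. -/
def cube₁ (e : Module.Basis (Fin n) ℝ (EuclideanSpace ℝ (Fin n))) :
    Set (EuclideanSpace ℝ (Fin n)) :=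
  parallelepiped e

/-- The cube at the origin generated by `e₁, …, eₙ₋₁` and `e₁ + ⋯ + eₙ₋₁ + 2 eₙ`. -/
noncomputable def cube₂ (e : Module.Basis (Fin n) ℝ (EuclideanSpace ℝ (Fin n))) :
    Set (EuclideanSpace ℝ (Fin n)) :=
  parallelepiped fun i : Fin n =>
    if (i : ℕ) + 1 = n then (∑ j ∈ Finset.univ.erase i, e j) + (2 : ℝ) • e i else e i

/-- The cube at the origin generated by `e₁` and `e₁ + 2 eᵢ` for `i = 2, …, n`. -/
noncomputable def cube₃ (e : Module.Basis (Fin n) ℝ (EuclideanSpace ℝ (Fin n))) :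
    Set (EuclideanSpace ℝ (Fin n)) :=
  parallelepiped fun i : Fin n =>
    if (i : ℕ) = 0 then e i else e ⟨0, i.pos⟩ + (2 : ℝ) • e i

/-- The `n`-dimensional polytope `P` in `ℝⁿ` has lattice volume `c`: there is a minimal Euclidean
volume `V₀` of a nondegenerate `n`-dimensional simplex with lattice vertices, and the Euclidean
volume of `P` divided by `V₀` is `c`. In dimension one this is the lattice length. -/
def HasLatticeVolume (L : Submodule ℤ (EuclideanSpace ℝ (Fin n)))
    (P : Set (EuclideanSpace ℝ (Fin n))) (c : ℝ) : Prop :=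
  ∃ V₀ : ℝ,
    IsLeast {V : ℝ | ∃ s : Fin (n + 1) → EuclideanSpace ℝ (Fin n),
      (∀ i, s i ∈ L) ∧ AffineIndependent ℝ s ∧
        V = MeasureTheory.volume.real (convexHull ℝ (Set.range s))} V₀ ∧
    MeasureTheory.volume.real P / V₀ = c

end Cubes

end LatticeGeometry

open LatticeGeometry

namespace LatticeGeometry

/-! ### Faces, flags and flag-transitivity under affine isomorphisms. -/

section Transport

variable {E E' : Type*} [NormedAddCommGroup E] [NormedSpace ℝ E]
  [NormedAddCommGroup E'] [NormedSpace ℝ E']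

/-! Use the edges of the cube as coordinates. The cube becomes `[0,1]ⁿ` and the lattice becomes a
group `Λ ⊇ ℤⁿ`, which determines the cube up to congruence (`latticeCongruent_parallelepiped`). An
affine map fixing a full flag of the cube is the identity (`eq_refl_of_image_stdFace`), so
lattice-regularity says exactly that `Λ` is invariant under all permutations and reflections of the
unit cube.

Subtracting from a point of `Λ` its reflection in one coordinate gives `2 xᵢ eᵢ ∈ Λ`, up to an
integer vector. Being elementary forces the axis vectors of `Λ` to be integral, so `Λ ⊆ ½ℤⁿ`, and
`Λ/ℤⁿ` is a permutation-invariant binary code with no word of weight one. The only such codes are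
zero, the repetition code and the even-weight code (`invariant_lattice_trichotomy`); these are the
lattices of the three model cubes. For `n = 1` only the zero code survives, and for `n = 2` the last
two coincide.

Conversely these three lattices are invariant, so the models are regular. Volumes reduce to
determinants: a lattice simplex has volume at least `1/n!` times that of the fundamental cell, with
equality for a basis, so a cube has lattice volume `|det| · n!`. Congruence preserves volume, and
this separates the models. -/

theorem IsFace.image (A : E ≃ᵃ[ℝ] E') {P F : Set E} (h : IsFace P F) :
    IsFace (A '' P) (A '' F) := by
  obtain ⟨l, c, hl, hle, rfl, x₀, hx₀⟩ := h
  -- The functional is transported by the linear part alone; the translation part of `A` only shifts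
  -- the level by `c₀`.
  obtain ⟨c₀, key⟩ : ∃ c₀, ∀ x, l (A.linear.symm (A x)) = l x + c₀ := by
    refine ⟨l (A.linear.symm (A 0)), fun x => ?_⟩
    have hx : A x = A.linear x + A 0 := by simpa using A.map_vadd 0 x
    rw [hx, map_add, map_add, LinearEquiv.symm_apply_apply]
  refine ⟨l ∘ₗ A.linear.symm.toLinearMap, c + c₀, ?_, ?_, ?_,
    ⟨A x₀, x₀, hx₀, rfl⟩⟩
  · intro h0
    apply hl
    ext x
    simpa using LinearMap.congr_fun h0 (A.linear x)
  · rintro _ ⟨x, hx, rfl⟩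
    simpa [key] using hle x hx
  · ext y
    constructor
    · rintro ⟨x, ⟨hx, hxc⟩, rfl⟩
      exact ⟨⟨x, hx, rfl⟩, by simp [key, hxc]⟩
    · rintro ⟨⟨x, hx, rfl⟩, hxc⟩
      exact ⟨x, ⟨hx, by simpa [key] using hxc⟩, rfl⟩

theorem dim_image (A : E ≃ᵃ[ℝ] E') (P : Set E) : dim (A '' P) = dim P := by
  have h : vectorSpan ℝ (A '' P) = (vectorSpan ℝ P).map A.linear.toLinearMap :=
    (AffineMap.map_vectorSpan (A : E →ᵃ[ℝ] E') (s := P)).symm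
  rw [dim, dim, h]
  exact LinearEquiv.finrank_map_eq A.linear _

theorem IsFaceFlag.image (A : E ≃ᵃ[ℝ] E') {P : Set E} {d : ℕ} {F : Fin (d + 1) → Set E}
    (h : IsFaceFlag P d F) : IsFaceFlag (A '' P) d (fun i => A '' F i) where
  top := by rw [h.top]
  dim_eq i := by rw [dim_image, h.dim_eq]
  face i := (h.face i).image A

/-- The affine transformations preserving `Λ` and `P` act transitively on the face-flags of `P`. -/
def FlagTransitive (Λ P : Set E) : Prop :=
  ∀ (d : ℕ) (F G : Fin (d + 1) → Set E), IsFaceFlag P d F → IsFaceFlag P d G →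
    ∃ f : E ≃ᵃ[ℝ] E, f '' Λ = Λ ∧ f '' P = P ∧ ∀ i, f '' F i = G i

theorem FlagTransitive.image (A : E ≃ᵃ[ℝ] E') {Λ P : Set E} (h : FlagTransitive Λ P) :
    FlagTransitive (A '' Λ) (A '' P) := by
  intro d F G hF hG
  have hs : ∀ S : Set E, A.symm '' (A '' S) = S := fun S => by simp [Set.image_image]
  have hs' : ∀ S : Set E', A '' (A.symm '' S) = S := fun S => by
    rw [Set.image_image]; simp
  have hF' := hF.image A.symm
  have hG' := hG.image A.symm
  rw [hs] at hF' hG'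
  obtain ⟨f, h₁, h₂, h₃⟩ := h d _ _ hF' hG'
  have hc : ∀ S, ((A.symm.trans f).trans A) '' S = A '' (f '' (A.symm '' S)) := fun S => by
    rw [Set.image_image, Set.image_image]; rfl
  refine ⟨(A.symm.trans f).trans A, ?_, ?_, fun i => ?_⟩
  · rw [hc, hs, h₁]
  · rw [hc, hs, h₂]
  · rw [hc, h₃, hs']

end Transport

/-! ### Faces, flags and symmetries of the unit cube. -/

section UnitCube

variable {n : ℕ}

/-- The face of the unit cube on which every coordinate outside `T` agrees with that of `ε`. -/
def cubeFace (T : Finset (Fin n)) (ε : Fin n → ℝ) : Set (Fin n → ℝ) :=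
  {x | x ∈ Set.Icc (0 : Fin n → ℝ) 1 ∧ ∀ i ∉ T, x i = ε i}

/-- The vertices of the unit cube. -/
def IsVertex (ε : Fin n → ℝ) : Prop := ∀ i, ε i = 0 ∨ ε i = 1

theorem isVertex_zero : IsVertex (0 : Fin n → ℝ) := fun _ => Or.inl rfl

theorem IsVertex.comp {ε : Fin n → ℝ} (h : IsVertex ε) (τ : Equiv.Perm (Fin n)) :
    IsVertex (ε ∘ τ) := fun i => h (τ i)

theorem IsVertex.mem_Icc {ε : Fin n → ℝ} (h : IsVertex ε) (i : Fin n) :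
    0 ≤ ε i ∧ ε i ≤ 1 := by
  rcases h i with h | h <;> rw [h] <;> norm_num

theorem IsVertex.mem_cubeFace {ε : Fin n → ℝ} (h : IsVertex ε) (T : Finset (Fin n)) :
    ε ∈ cubeFace T ε :=
  ⟨⟨fun i => (h.mem_Icc i).1, fun i => (h.mem_Icc i).2⟩, fun _ _ => rfl⟩

theorem IsVertex.update_mem_cubeFace {ε : Fin n → ℝ} (h : IsVertex ε) {T : Finset (Fin n)}
    {i : Fin n} (hi : i ∈ T) {a : ℝ} (ha : 0 ≤ a) (ha' : a ≤ 1) :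
    Function.update ε i a ∈ cubeFace T ε := by
  refine ⟨⟨fun j => ?_, fun j => ?_⟩, fun j hj => ?_⟩
  · by_cases hji : j = i
    · subst hji; simpa using ha
    · simpa [hji] using (h.mem_Icc j).1
  · by_cases hji : j = i
    · subst hji; simpa using ha'
    · simpa [hji] using (h.mem_Icc j).2
  · have : j ≠ i := fun h => hj (h ▸ hi)
    simp [this]

theorem cubeFace_univ (ε : Fin n → ℝ) : cubeFace Finset.univ ε = Set.Icc 0 1 := by
  ext x; simp [cubeFace]

theorem vectorSpan_cubeFace {ε : Fin n → ℝ} (h : IsVertex ε) (T : Finset (Fin n)) :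
    vectorSpan ℝ (cubeFace T ε) =
      ⨅ i ∈ ((↑T : Set (Fin n))ᶜ), LinearMap.ker (LinearMap.proj i : (Fin n → ℝ) →ₗ[ℝ] ℝ) := by
  apply le_antisymm
  · rw [vectorSpan, Submodule.span_le]
    rintro _ ⟨x, hx, y, hy, rfl⟩
    simp only [Submodule.coe_iInf, Set.mem_iInter]
    intro i hi
    have hi' : i ∉ T := by simpa using hi
    simp [hx.2 i hi', hy.2 i hi']
  · intro x hx
    simp only [Submodule.mem_iInf, LinearMap.mem_ker, LinearMap.proj_apply] at hx
    rw [pi_eq_sum_univ' x]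
    refine Submodule.sum_mem _ fun i _ => ?_
    by_cases hi : i ∈ T
    · refine Submodule.smul_mem _ _ ?_
      -- The `i`-th unit vector is the difference of the points of the face obtained from `ε` by
      -- setting coordinate `i` to `1` and to `0`.
      have := vsub_mem_vectorSpan ℝ (h.update_mem_cubeFace hi zero_le_one le_rfl)
        (h.update_mem_cubeFace hi le_rfl zero_le_one)
      convert this using 1
      ext j
      by_cases hj : j = i
      · subst hj; simp
      · simp [hj]
    · rw [hx i (by simpa using hi)]; simp

theorem dim_cubeFace {ε : Fin n → ℝ} (h : IsVertex ε) (T : Finset (Fin n)) :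
    dim (cubeFace T ε) = T.card := by
  rw [dim, vectorSpan_cubeFace h,
    (LinearMap.iInfKerProjEquiv ℝ (fun _ : Fin n => ℝ) (I := (↑T : Set (Fin n)))
      (J := (↑T : Set (Fin n))ᶜ) disjoint_compl_right (by simp)).finrank_eq]
  simp

/-- A linear functional on a box is maximised one coordinate at a time: the sign of each nonzero
coefficient fixes that coordinate, and zero coefficients leave it free. -/
theorem exists_eq_cubeFace_of_isFace {ε : Fin n → ℝ} (h : IsVertex ε) {T : Finset (Fin n)}
    {F : Set (Fin n → ℝ)} (hF : IsFace (cubeFace T ε) F) :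
    ∃ T' ε', IsVertex ε' ∧ F = cubeFace T' ε' := by
  classical
  obtain ⟨l, c, -, hle, rfl, y, hy, hyc⟩ := hF
  set a : Fin n → ℝ := fun i => l (Pi.single i 1) with ha
  have hl : ∀ x, l x = ∑ i, a i * x i := fun x => by
    conv_lhs => rw [pi_eq_sum_univ' x, map_sum]
    refine Finset.sum_congr rfl fun i _ => ?_
    rw [map_smul, smul_eq_mul, mul_comm, ha]
  set ε' : Fin n → ℝ := fun i => if i ∈ T then (if 0 < a i then 1 else 0) else ε i with hε'
  have hv : IsVertex ε' := fun i => by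
    simp only [hε']
    split_ifs
    · exact Or.inr rfl
    · exact Or.inl rfl
    · exact h i
  have hmem : ε' ∈ cubeFace T ε := by
    refine ⟨⟨fun i => (hv.mem_Icc i).1, fun i => (hv.mem_Icc i).2⟩, fun i hi => ?_⟩
    simp [hε', hi]
  have hterm : ∀ x ∈ cubeFace T ε, ∀ i, a i * x i ≤ a i * ε' i := by
    intro x hx i
    by_cases hi : i ∈ T
    · by_cases hpos : 0 < a i
      · have : x i ≤ 1 := hx.1.2 i
        simp only [hε', hi, hpos, if_true]
        nlinarith
      · have : 0 ≤ x i := hx.1.1 i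
        simp only [hε', hi, hpos, if_true, if_false]
        nlinarith
    · simp [hε', hi, hx.2 i hi]
  have hc : c = l ε' := by
    apply le_antisymm _ (hle _ hmem)
    rw [← hyc, hl, hl]
    exact Finset.sum_le_sum fun i _ => hterm y hy i
  refine ⟨T.filter (fun i => a i = 0), ε', hv, ?_⟩
  ext x
  constructor
  · rintro ⟨hx, hxc⟩
    refine ⟨hx.1, fun i hi => ?_⟩
    -- Equality of the sums, together with the termwise inequality, forces equality in every term.
    rw [hc, hl, hl, Finset.sum_eq_sum_iff_of_le (fun i _ => hterm x hx i)] at hxc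
    by_cases hiT : i ∈ T
    · have : a i ≠ 0 := fun h => hi (by simp [hiT, h])
      exact mul_left_cancel₀ this (hxc i (Finset.mem_univ _))
    · simp [hε', hiT, hx.2 i hiT]
  · rintro ⟨hx, hxe⟩
    refine ⟨⟨hx, fun i hi => ?_⟩, ?_⟩
    · rw [hxe i (by simp [hi])]; simp [hε', hi]
    · rw [hc, hl, hl]
      refine Finset.sum_congr rfl fun i _ => ?_
      by_cases h0 : a i = 0
      · simp [h0]
      · rw [hxe i (by simp [h0])]

theorem subset_of_cubeFace_subset {ε ε' : Fin n → ℝ} (h : IsVertex ε) {T T' : Finset (Fin n)}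
    (hsub : cubeFace T ε ⊆ cubeFace T' ε') : T ⊆ T' := by
  intro i hi
  by_contra hi'
  have h₁ := (hsub (h.update_mem_cubeFace hi zero_le_one le_rfl)).2 i hi'
  have h₀ := (hsub (h.update_mem_cubeFace hi le_rfl zero_le_one)).2 i hi'
  simp at h₁ h₀
  rw [← h₀] at h₁
  norm_num at h₁

theorem dim_Icc : dim (Set.Icc (0 : Fin n → ℝ) 1) = n := by
  rw [← cubeFace_univ 0, dim_cubeFace isVertex_zero]
  simp

/-- A maximal chain of subsets is the chain of initial segments of an enumeration. -/
theorem exists_perm_of_chain (T : Fin (n + 1) → Finset (Fin n)) (hT : Monotone T)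
    (hcard : ∀ k, (T k).card = k) :
    ∃ τ : Equiv.Perm (Fin n), ∀ k j, τ j ∈ T k ↔ (j : ℕ) < k := by
  -- The enumeration lists at place `j` the element that enters the chain at that step.
  have hex : ∀ j : Fin n, ∃ i, i ∈ T j.succ ∧ i ∉ T j.castSucc := by
    intro j
    by_contra! hcon
    have := Finset.card_le_card (show T j.succ ⊆ T j.castSucc from hcon)
    simp [hcard] at this
  choose τ hτ hτ' using hex
  have hmem : ∀ k j, τ j ∈ T k ↔ (j : ℕ) < k := by
    intro k j
    constructor
    · intro h
      by_contra hk
      exact hτ' j (hT (Fin.le_def.2 (by simpa using hk)) h)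
    · intro h
      exact hT (Fin.le_def.2 (by simpa using h)) (hτ j)
  have hinj : Function.Injective τ := by
    intro j j' hjj
    have h₁ := (hmem j'.succ j).1 (by rw [hjj]; exact hτ j')
    have h₂ := (hmem j.succ j').1 (by rw [← hjj]; exact hτ j)
    simp at h₁ h₂
    exact Fin.ext (by omega)
  exact ⟨Equiv.ofBijective τ (Finite.injective_iff_bijective.1 hinj), hmem⟩

/-- The symmetry of the unit cube that permutes the coordinates by `τ` and then reflects the
coordinates where `ε` is `1`. -/
noncomputable def cubeSymm (τ : Equiv.Perm (Fin n)) (ε : Fin n → ℝ) (hε : IsVertex ε) :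
    (Fin n → ℝ) ≃ᵃ[ℝ] (Fin n → ℝ) where
  toFun x i := ε i + (1 - 2 * ε i) * x (τ.symm i)
  invFun x j := ε (τ j) + (1 - 2 * ε (τ j)) * x (τ j)
  left_inv x := by
    ext j
    rcases hε (τ j) with h | h <;> norm_num [h]
  right_inv x := by
    ext j
    rcases hε j with h | h <;> norm_num [h]
  linear :=
    { toFun := fun x i => (1 - 2 * ε i) * x (τ.symm i)
      invFun := fun x j => (1 - 2 * ε (τ j)) * x (τ j)
      map_add' := fun x y => by ext; simp; ring
      map_smul' := fun c x => by ext; simp; ring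
      left_inv := fun x => by
        ext j
        rcases hε (τ j) with h | h <;> norm_num [h]
      right_inv := fun x => by
        ext j
        rcases hε j with h | h <;> norm_num [h] }
  map_vadd' x v := by
    ext i
    simp
    ring

theorem cubeSymm_apply (τ : Equiv.Perm (Fin n)) (ε : Fin n → ℝ) (hε : IsVertex ε)
    (x : Fin n → ℝ) (i : Fin n) :
    cubeSymm τ ε hε x i = ε i + (1 - 2 * ε i) * x (τ.symm i) := rfl

theorem cubeSymm_symm (τ : Equiv.Perm (Fin n)) (ε : Fin n → ℝ) (hε : IsVertex ε) :
    (cubeSymm τ ε hε).symm = cubeSymm τ.symm (ε ∘ τ) (hε.comp τ) := by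
  ext x j
  rfl

/-- The standard face-flag of the unit cube. -/
def stdFace (n k : ℕ) : Set (Fin n → ℝ) :=
  {x | x ∈ Set.Icc (0 : Fin n → ℝ) 1 ∧ ∀ i : Fin n, k ≤ i → x i = 0}

theorem stdFace_eq_cubeFace (k : ℕ) :
    stdFace n k = cubeFace (Finset.univ.filter fun i : Fin n => (i : ℕ) < k) 0 := by
  ext x; simp [stdFace, cubeFace]

/-- The symmetry moves the origin to `ε` and the `j`-th axis direction to the `τ j`-th, so the free
coordinates `j < k` become those in `T`. -/
theorem cubeSymm_image_stdFace (τ : Equiv.Perm (Fin n)) (ε : Fin n → ℝ) (hε : IsVertex ε)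
    (k : ℕ) (T : Finset (Fin n)) (hT : ∀ j, τ j ∈ T ↔ (j : ℕ) < k) :
    cubeSymm τ ε hε '' stdFace n k = cubeFace T ε := by
  have hIcc : ∀ (τ : Equiv.Perm (Fin n)) (ε : Fin n → ℝ) (hε : IsVertex ε),
      ∀ x ∈ Set.Icc (0 : Fin n → ℝ) 1, cubeSymm τ ε hε x ∈ Set.Icc (0 : Fin n → ℝ) 1 := by
    intro τ ε hε x hx
    refine ⟨fun i => ?_, fun i => ?_⟩
    all_goals
      have h₀ : 0 ≤ x (τ.symm i) := hx.1 _
      have h₁ : x (τ.symm i) ≤ 1 := hx.2 _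
      rcases hε i with h | h <;> simp [cubeSymm_apply, h] <;> linarith
  ext y
  constructor
  · rintro ⟨x, ⟨hx, hx0⟩, rfl⟩
    refine ⟨hIcc _ _ _ x hx, fun i hi => ?_⟩
    obtain ⟨j, rfl⟩ := τ.surjective i
    rw [hT, not_lt] at hi
    simp [cubeSymm_apply, hx0 j hi]
  · rintro ⟨hy, hyε⟩
    refine ⟨(cubeSymm τ ε hε).symm y, ⟨?_, fun i hi => ?_⟩, by simp⟩
    · rw [cubeSymm_symm]; exact hIcc _ _ _ y hy
    · have : y (τ i) = ε (τ i) := hyε _ (by rw [hT]; omega)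
      rw [cubeSymm_symm, cubeSymm_apply]
      simp only [Function.comp_apply, Equiv.symm_symm, this]
      rcases hε (τ i) with h | h <;> rw [h] <;> ring

theorem stdFace_self : stdFace n n = Set.Icc 0 1 := by
  ext x
  simp only [stdFace, Set.mem_ofPred_eq, and_iff_left_iff_imp]
  intro _ i hi
  omega

theorem isFaceFlag_stdFace :
    IsFaceFlag (Set.Icc (0 : Fin n → ℝ) 1) n (fun k => stdFace n k) where
  top := stdFace_self
  dim_eq k := by
    rw [stdFace_eq_cubeFace, dim_cubeFace isVertex_zero,
      Fin.card_filter_val_lt]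
    omega
  face k := by
    refine ⟨-LinearMap.proj k, 0, ?_, ?_, ?_, 0, ?_⟩
    · intro h
      have := LinearMap.congr_fun h (Pi.single k 1)
      simp at this
    · intro x hx
      simpa using hx.1.1 k
    · ext x
      constructor
      · rintro ⟨hx, hx0⟩
        exact ⟨⟨hx, fun i hi => hx0 i (by simp at hi ⊢; omega)⟩, by simpa using hx0 k (by simp)⟩
      · rintro ⟨⟨hx, hx0⟩, hxk⟩
        refine ⟨hx, fun i hi => ?_⟩
        by_cases hik : i = k
        · subst hik; simpa using hxk
        · refine hx0 i ?_
          have : (i : ℕ) ≠ k := fun h => hik (Fin.ext h)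
          simp at hi ⊢; omega
    · exact ⟨⟨le_rfl, fun _ => zero_le_one⟩, fun _ _ => rfl⟩

/-- Every face-flag of the unit cube is the image of the standard one under a symmetry. -/
theorem exists_cubeSymm_of_isFaceFlag {F : Fin (n + 1) → Set (Fin n → ℝ)}
    (hF : IsFaceFlag (Set.Icc (0 : Fin n → ℝ) 1) n F) :
    ∃ τ ε, ∃ hε : IsVertex ε, ∀ k : Fin (n + 1), cubeSymm τ ε hε '' stdFace n k = F k := by
  have hex : ∀ k, ∃ T ε, IsVertex ε ∧ F k = cubeFace T ε := by
    intro k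
    induction k using Fin.reverseInduction with
    | last => exact ⟨Finset.univ, 0, isVertex_zero, by rw [hF.top, cubeFace_univ]⟩
    | cast i ih =>
      obtain ⟨T, ε, hε, h⟩ := ih
      have := hF.face i
      rw [h] at this
      exact exists_eq_cubeFace_of_isFace hε this
  choose T ε hε hT using hex
  have hmonoF : Monotone F := by
    rw [Fin.monotone_iff_le_succ]
    intro i
    obtain ⟨l, c, -, -, h, -⟩ := hF.face i
    rw [h]
    exact fun x hx => hx.1
  have hmono : Monotone T := fun i j hij =>
    subset_of_cubeFace_subset (hε i) (by rw [← hT, ← hT]; exact hmonoF hij)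
  have hcard : ∀ k, (T k).card = k := fun k => by
    rw [← dim_cubeFace (hε k), ← hT, hF.dim_eq]
  obtain ⟨τ, hτ⟩ := exists_perm_of_chain T hmono hcard
  refine ⟨τ, ε 0, hε 0, fun k => ?_⟩
  rw [cubeSymm_image_stdFace τ _ _ k (T k) (hτ k), hT]
  -- The vertex of the flag lies in all its faces, so it can replace each `ε k` as the base vertex.
  have h0 : ε 0 ∈ cubeFace (T k) (ε k) := by
    rw [← hT]
    apply hmonoF (Fin.zero_le k)
    rw [hT]
    exact (hε 0).mem_cubeFace _
  ext x
  exact and_congr_right fun _ => forall₂_congr fun i hi => by rw [h0.2 i hi]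

theorem flagTransitive_Icc {Λ : Set (Fin n → ℝ)}
    (h : ∀ τ ε hε, ∀ x ∈ Λ, cubeSymm τ ε hε x ∈ Λ) :
    FlagTransitive Λ (Set.Icc (0 : Fin n → ℝ) 1) := by
  have himg : ∀ τ ε hε, cubeSymm τ ε hε '' Λ = Λ := fun τ ε hε => by
    apply Set.Subset.antisymm
    · rintro _ ⟨x, hx, rfl⟩
      exact h _ _ _ x hx
    · intro x hx
      refine ⟨(cubeSymm τ ε hε).symm x, ?_, by simp⟩
      rw [cubeSymm_symm]
      exact h _ _ _ x hx
  intro d F G hF hG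
  obtain rfl : d = n := by
    have := hF.dim_eq (Fin.last d)
    rw [hF.top, dim_Icc] at this
    simpa using this.symm
  obtain ⟨τ, ε, hε, hA⟩ := exists_cubeSymm_of_isFaceFlag hF
  obtain ⟨τ', ε', hε', hB⟩ := exists_cubeSymm_of_isFaceFlag hG
  have hs : ∀ S, (cubeSymm τ ε hε).symm '' (cubeSymm τ ε hε '' S) = S := fun S => by
    simp [Set.image_image]
  have hc : ∀ S, ((cubeSymm τ ε hε).symm.trans (cubeSymm τ' ε' hε')) '' S =
      cubeSymm τ' ε' hε' '' ((cubeSymm τ ε hε).symm '' S) := fun S => by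
    rw [Set.image_image]; rfl
  have hflag : ∀ i, ((cubeSymm τ ε hε).symm.trans (cubeSymm τ' ε' hε')) '' F i = G i :=
    fun i => by rw [hc, ← hA, hs, hB]
  refine ⟨(cubeSymm τ ε hε).symm.trans (cubeSymm τ' ε' hε'), ?_, ?_, hflag⟩
  · rw [hc]
    nth_rewrite 1 [← himg τ ε hε]
    rw [hs, himg]
  · have := hflag (Fin.last _)
    rwa [hF.top, hG.top] at this

/-- An affine transformation preserving the standard face-flag is the identity. -/
theorem eq_refl_of_image_stdFace (f : (Fin n → ℝ) ≃ᵃ[ℝ] (Fin n → ℝ))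
    (hf : ∀ k : Fin (n + 1), f '' stdFace n k = stdFace n k) (x : Fin n → ℝ) : f x = x := by
  have hmaps : ∀ k ≤ n, ∀ y ∈ stdFace n k, f y ∈ stdFace n k := fun k hk y hy => by
    have := hf ⟨k, by omega⟩
    simp only at this
    rw [← this]
    exact ⟨y, hy, rfl⟩
  have h0 : f 0 = 0 := by
    have := hmaps 0 (Nat.zero_le _) 0 ⟨⟨le_rfl, fun _ => zero_le_one⟩, fun _ _ => rfl⟩
    ext i
    exact this.2 i (Nat.zero_le _)
  have hlin : ∀ y, f y = f.linear y := fun y => by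
    have := f.map_vadd 0 y
    simpa [h0] using this
  have hfix : ∀ k : ℕ, ∀ j : Fin n, (j : ℕ) = k → f (Pi.single j 1) = Pi.single j 1 := by
    intro k
    induction k using Nat.strong_induction_on with
    | _ k ih =>
    intro j hj
    have hjn := j.2
    -- On this face `f` is known except for the image of the last basis vector, the earlier ones
    -- being fixed by induction.
    have hsum : ∀ y ∈ stdFace n (k + 1), ∀ i, f y i =
        (if i < j then y i else 0) + y j * f (Pi.single j 1) i := by
      intro y hy i
      have hy' : y = ∑ i : Fin n, y i • (Pi.single i 1 : Fin n → ℝ) := by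
        ext m; simp [Finset.sum_apply, Pi.single_apply]
      conv_lhs => rw [hy', hlin, map_sum, Finset.sum_apply]
      simp only [map_smul, Pi.smul_apply, smul_eq_mul]
      simp only [← hlin]
      rw [← Finset.sum_erase_add _ _ (Finset.mem_univ j)]
      congr 1
      rw [Finset.sum_congr rfl (g := fun m => if m = i then (if i < j then y i else 0) else 0)]
      · by_cases hij : i = j
        · subst hij; simp
        · simp [hij]
      · intro m hm
        have hmj : m ≠ j := (Finset.mem_erase.1 hm).1
        rcases lt_or_ge m j with hlt | hge
        · rw [ih m (by rw [← hj]; exact hlt) m rfl]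
          by_cases hmi : m = i
          · subst hmi; simp [hlt]
          · simp [hmi]
        · have hjm : j < m := lt_of_le_of_ne hge (Ne.symm hmj)
          rw [hy.2 m (by rw [← hj]; exact hjm)]
          by_cases hmi : m = i
          · subst hmi; simp [not_lt.2 hge]
          · simp [hmi]
    have hone : (fun i : Fin n => if i ≤ j then (1 : ℝ) else 0) ∈ stdFace n (k + 1) := by
      refine ⟨⟨fun i => ?_, fun i => ?_⟩, fun i hi => ?_⟩
      · show (0 : ℝ) ≤ if i ≤ j then 1 else 0
        split_ifs <;> norm_num
      · show (if i ≤ j then 1 else 0) ≤ (1 : ℝ)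
        split_ifs <;> norm_num
      · have : ¬ i ≤ j := by rw [Fin.le_def]; omega
        simp [this]
    have hsingle : (Pi.single j 1 : Fin n → ℝ) ∈ stdFace n (k + 1) := by
      refine ⟨⟨?_, ?_⟩, fun i hi => ?_⟩
      · simp [Pi.single_nonneg]
      · intro i; rw [Pi.single_apply, Pi.one_apply]; split_ifs <;> norm_num
      · have : i ≠ j := fun h => by subst h; omega
        simp [this]
    have him := hmaps (k + 1) (by omega) _ hsingle
    have him1 := hmaps (k + 1) (by omega) _ hone
    obtain ⟨b, hb, hfb⟩ : (Pi.single j 1 : Fin n → ℝ) ∈ f '' stdFace n (k + 1) := by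
      have := hf ⟨k + 1, by omega⟩
      simp only at this
      rw [this]; exact hsingle
    ext i
    rcases lt_trichotomy i j with hij | rfl | hij
    -- The vertex with all free coordinates `1` has `i`-th image coordinate `1 + f(eⱼ)ᵢ`, which must
    -- not exceed `1`.
    · have h₁ : f (fun i : Fin n => if i ≤ j then (1 : ℝ) else 0) i ≤ 1 := him1.1.2 i
      rw [hsum _ hone] at h₁
      have h₂ : 0 ≤ f (Pi.single j 1) i := him.1.1 i
      simp [hij, hij.le] at h₁
      rw [Pi.single_eq_of_ne hij.ne]
      linarith
    -- The preimage `b` of the basis vector gives `1` as a product of two numbers in `[0,1]`, so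
    -- both equal `1`.
    · have h₁ := congrFun hfb i
      rw [hsum b hb] at h₁
      simp at h₁
      have h₂ : b i ≤ 1 := hb.1.2 i
      have h₃ : 0 ≤ b i := hb.1.1 i
      have h₄ : f (Pi.single i 1) i ≤ 1 := him.1.2 i
      have h₅ : 0 ≤ f (Pi.single i 1) i := him.1.1 i
      rw [Pi.single_eq_same]
      nlinarith
    · rw [him.2 i (by have := Fin.lt_def.1 hij; omega), Pi.single_eq_of_ne hij.ne']
  have hx : x = ∑ i : Fin n, x i • (Pi.single i 1 : Fin n → ℝ) := by
    ext m; simp [Finset.sum_apply, Pi.single_apply]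
  conv_lhs => rw [hx, hlin, map_sum]
  conv_rhs => rw [hx]
  refine Finset.sum_congr rfl fun i _ => ?_
  rw [map_smul, ← hlin, hfix i i rfl]

/-- The map supplied by transitivity from the standard flag to its image under the symmetry must be
that symmetry, by rigidity of flags. Thus every symmetry of the cube preserves `Λ`. -/
theorem FlagTransitive.cubeSymm_image {Λ : Set (Fin n → ℝ)}
    (h : FlagTransitive Λ (Set.Icc (0 : Fin n → ℝ) 1)) (τ : Equiv.Perm (Fin n))
    {ε : Fin n → ℝ} (hε : IsVertex ε) : cubeSymm τ ε hε '' Λ = Λ := by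
  have hIcc : cubeSymm τ ε hε '' Set.Icc (0 : Fin n → ℝ) 1 = Set.Icc 0 1 := by
    rw [← stdFace_self, cubeSymm_image_stdFace τ ε hε n Finset.univ (by simp), cubeFace_univ,
      stdFace_self]
  have hG := (isFaceFlag_stdFace (n := n)).image (cubeSymm τ ε hε)
  rw [hIcc] at hG
  obtain ⟨f, hfΛ, -, hf⟩ := h n _ _ isFaceFlag_stdFace hG
  have hid := eq_refl_of_image_stdFace (f.trans (cubeSymm τ ε hε).symm) fun k => by
    have : (f.trans (cubeSymm τ ε hε).symm) '' stdFace n k =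
        (cubeSymm τ ε hε).symm '' (f '' stdFace n k) := by simp [Set.image_image]
    rw [this, hf]
    simp [Set.image_image]
  have hfs : ∀ x, f x = cubeSymm τ ε hε x := fun x => by
    have := congrArg (cubeSymm τ ε hε) (hid x)
    simpa using this
  rw [← Set.image_congr (fun x _ => hfs x), hfΛ]

end UnitCube

/-! ### Classification of the lattices invariant under the symmetries of the unit cube. -/

section InvariantLattices

/-- The integers as a subgroup of the reals. -/
def intReal : AddSubgroup ℝ := (Int.castAddHom ℝ).range

theorem mem_intReal {a : ℝ} : a ∈ intReal ↔ ∃ k : ℤ, (k : ℝ) = a := Iff.rfl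

theorem intCast_mem_intReal (k : ℤ) : (k : ℝ) ∈ intReal := mem_intReal.2 ⟨k, rfl⟩

theorem two_mul_mem_intReal {a : ℝ} (h : a ∈ intReal) : 2 * a ∈ intReal := by
  rw [two_mul]; exact add_mem h h

theorem half_cases {a : ℝ} (h : 2 * a ∈ intReal) : a ∈ intReal ∨ a - 1 / 2 ∈ intReal := by
  obtain ⟨k, hk⟩ := mem_intReal.1 h
  rcases Int.even_or_odd' k with ⟨c, rfl | rfl⟩
  · exact Or.inl (mem_intReal.2 ⟨c, by push_cast at hk; linarith⟩)
  · exact Or.inr (mem_intReal.2 ⟨c, by push_cast at hk; linarith⟩)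

variable {n : ℕ}

/-- All coordinates are integers. -/
def IsIntegral (x : Fin n → ℝ) : Prop := ∀ i, x i ∈ intReal

/-- Either all coordinates are integers, or all of them are half-odd. -/
def IsBodyCentered (x : Fin n → ℝ) : Prop :=
  (∀ i, x i ∈ intReal) ∨ ∀ i, x i - 1 / 2 ∈ intReal

/-- All coordinates are integers or half-odd, and their sum is an integer. -/
def IsHalfEven (x : Fin n → ℝ) : Prop :=
  (∀ i, 2 * x i ∈ intReal) ∧ ∑ i, x i ∈ intReal

theorem IsVertex.mem_intReal {ε : Fin n → ℝ} (h : IsVertex ε) (i : Fin n) : ε i ∈ intReal := by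
  rcases h i with h | h <;> rw [h]
  · exact zero_mem _
  · simpa using intCast_mem_intReal 1

theorem IsIntegral.cubeSymm {x : Fin n → ℝ} (hx : IsIntegral x) (τ : Equiv.Perm (Fin n))
    {ε : Fin n → ℝ} (hε : IsVertex ε) : IsIntegral (cubeSymm τ ε hε x) := by
  intro i
  rw [cubeSymm_apply]
  refine add_mem (hε.mem_intReal i) ?_
  rcases hε i with h | h <;> rw [h]
  · simpa using hx (τ.symm i)
  · convert! neg_mem (hx (τ.symm i)) using 1
    ring

theorem IsBodyCentered.cubeSymm {x : Fin n → ℝ} (hx : IsBodyCentered x) (τ : Equiv.Perm (Fin n))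
    {ε : Fin n → ℝ} (hε : IsVertex ε) : IsBodyCentered (cubeSymm τ ε hε x) := by
  rcases hx with hx | hx
  · exact Or.inl (IsIntegral.cubeSymm hx τ hε)
  · refine Or.inr fun i => ?_
    rw [cubeSymm_apply]
    rcases hε i with h | h <;> rw [h]
    · simpa using hx (τ.symm i)
    · convert! neg_mem (hx (τ.symm i)) using 1
      ring

theorem IsHalfEven.cubeSymm {x : Fin n → ℝ} (hx : IsHalfEven x) (τ : Equiv.Perm (Fin n))
    {ε : Fin n → ℝ} (hε : IsVertex ε) : IsHalfEven (cubeSymm τ ε hε x) := by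
  -- A reflection changes a half-integer `a` by the integer `1 - 2a`, so modulo `ℤⁿ` only the
  -- permutation acts.
  have key : ∀ i, LatticeGeometry.cubeSymm τ ε hε x i - x (τ.symm i) ∈ intReal := fun i => by
    rw [cubeSymm_apply]
    rcases hε i with h | h <;> rw [h]
    · simp
    · convert! sub_mem (intCast_mem_intReal 1) (hx.1 (τ.symm i)) using 1
      push_cast; ring
  constructor
  · intro i
    convert! add_mem (two_mul_mem_intReal (key i)) (hx.1 (τ.symm i)) using 1
    ring
  · have h₁ := sum_mem (t := Finset.univ) fun i _ => key i
    rw [Finset.sum_sub_distrib, Equiv.sum_comp τ.symm x] at h₁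
    simpa using add_mem h₁ hx.2

/-- The lattices containing `ℤⁿ` that are invariant under the symmetries of the unit cube and have
no vector shorter than `1` on the coordinate axes. -/
theorem invariant_lattice_trichotomy (Λ : AddSubgroup (Fin n → ℝ))
    (hsingle : ∀ i, Pi.single i 1 ∈ Λ)
    (hperm : ∀ (τ : Equiv.Perm (Fin n)), ∀ x ∈ Λ, (fun i => x (τ i)) ∈ Λ)
    (hflip : ∀ i, ∀ x ∈ Λ, Pi.single i (2 * x i) ∈ Λ)
    (hint : ∀ i a, Pi.single i a ∈ Λ → a ∈ intReal) :
    (∀ x, x ∈ Λ ↔ IsIntegral x) ∨ ((∀ x, x ∈ Λ ↔ IsBodyCentered x) ∧ n ≠ 1) ∨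
      ((∀ x, x ∈ Λ ↔ IsHalfEven x) ∧ n ≠ 1) := by
  have hzs : ∀ (i : Fin n) (a : ℝ) (k : ℤ), Pi.single i a ∈ Λ →
      (Pi.single i (k * a) : Fin n → ℝ) ∈ Λ := fun i a k h => by
    have := Λ.zsmul_mem h k
    rwa [← Pi.single_smul, zsmul_eq_mul] at this
  have hsum : ∀ x : Fin n → ℝ, x = ∑ i, Pi.single i (x i) := fun x =>
    (Finset.univ_sum_single x).symm
  have hZ : ∀ x, IsIntegral x → x ∈ Λ := fun x hx => by
    rw [hsum x]
    refine sum_mem fun i _ => ?_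
    obtain ⟨k, hk⟩ := mem_intReal.1 (hx i)
    simpa [hk] using hzs i 1 k (hsingle i)
  have hhalf : ∀ x ∈ Λ, ∀ i, 2 * x i ∈ intReal := fun x hx i => hint i _ (hflip i x hx)
  by_cases h₁ : ∀ x ∈ Λ, IsIntegral x
  · exact Or.inl fun x => ⟨h₁ x, hZ x⟩
  right
  by_cases h₂ : ∀ x ∈ Λ, IsBodyCentered x
  · left
    push Not at h₁
    obtain ⟨y, hy, hy'⟩ := h₁
    have hyh : ∀ i, y i - 1 / 2 ∈ intReal := (h₂ y hy).resolve_left hy'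
    constructor
    · refine fun x => ⟨h₂ x, ?_⟩
      rintro (hx | hx)
      · exact hZ x hx
      · have : IsIntegral (x - y) := fun i => by
          convert! sub_mem (hx i) (hyh i) using 1
          simp
        simpa using add_mem (hZ _ this) hy
    · rintro rfl
      -- In dimension one every vector lies on an axis, so `hint` would make `y` integral.
      have hy0 : y = Pi.single 0 (y 0) := by
        ext i
        rw [Subsingleton.elim i 0]; simp
      rw [hy0] at hy
      exact hy' fun i => by rw [Subsingleton.elim i 0]; exact hint 0 _ hy
  · right
    push Not at h₂
    obtain ⟨y, hy, hy'⟩ := h₂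
    obtain ⟨i, j, hi, hj⟩ : ∃ i j, y i ∉ intReal ∧ y j ∈ intReal := by
      simp only [IsBodyCentered, not_or, not_forall] at hy'
      obtain ⟨⟨i, hi⟩, ⟨j, hj⟩⟩ := hy'
      exact ⟨i, j, hi, (half_cases (hhalf y hy j)).resolve_right hj⟩
    have hij : i ≠ j := fun h => hi (h ▸ hj)
    have hi' : y i - 1 / 2 ∈ intReal := (half_cases (hhalf y hy i)).resolve_left hi
    -- Swapping coordinates `i` and `j` of `y` and subtracting leaves `(yᵢ - yⱼ)(eᵢ - eⱼ)`, whose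
    -- coefficient is half-odd.
    have hpair : (Pi.single i (1 / 2) - Pi.single j (1 / 2) : Fin n → ℝ) ∈ Λ := by
      have h := sub_mem hy (hperm (Equiv.swap i j) y hy)
      have hd : IsIntegral ((Pi.single i (1 / 2) - Pi.single j (1 / 2) : Fin n → ℝ) -
          (y - fun k => y (Equiv.swap i j k))) := by
        intro k
        by_cases hki : k = i
        · subst hki
          simp only [Pi.sub_apply, Pi.single_eq_same, Pi.single_eq_of_ne hij,
            Equiv.swap_apply_left]
          convert! sub_mem hj hi' using 1
          ring
        · by_cases hkj : k = j
          · subst hkj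
            simp only [Pi.sub_apply, Pi.single_eq_same, Pi.single_eq_of_ne hij.symm,
              Equiv.swap_apply_right]
            convert! sub_mem hi' hj using 1
            ring
          · simp [hki, hkj, Equiv.swap_apply_of_ne_of_ne hki hkj, zero_mem]
      simpa using add_mem (hZ _ hd) h
    have hpairs : ∀ k, (Pi.single k (1 / 2) - Pi.single j (1 / 2) : Fin n → ℝ) ∈ Λ := by
      intro k
      by_cases hkj : k = j
      · subst hkj; simp [zero_mem]
      · convert! hperm (Equiv.swap i k) _ hpair using 1
        ext m
        have h₁ : Equiv.swap i k m = i ↔ m = k := by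
          rw [Equiv.swap_apply_eq_iff, Equiv.swap_apply_left]
        have h₂ : Equiv.swap i k m = j ↔ m = j := by
          rw [Equiv.swap_apply_eq_iff, Equiv.swap_apply_of_ne_of_ne hij.symm (Ne.symm hkj)]
        simp [Pi.single_apply, h₁, h₂]
    -- The vectors `½(eₖ - eⱼ)` move all of `x` onto the `j`-th axis; membership in `Λ` is then
    -- decided by the coordinate sum.
    have hhalfΛ : ∀ x : Fin n → ℝ, (∀ k, 2 * x k ∈ intReal) →
        x - Pi.single j (∑ k, x k) ∈ Λ := by
      intro x hx
      have : x - Pi.single j (∑ k, x k) =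
          ∑ k, (Pi.single k (x k) - Pi.single j (x k) : Fin n → ℝ) := by
        rw [Finset.sum_sub_distrib, ← hsum]
        congr 1
        ext m
        by_cases hm : m = j
        · subst hm; simp
        · simp [hm]
      rw [this]
      refine sum_mem fun k _ => ?_
      obtain ⟨c, hc⟩ := mem_intReal.1 (hx k)
      have h := Λ.zsmul_mem (hpairs k) c
      rw [smul_sub, ← Pi.single_smul, ← Pi.single_smul, zsmul_eq_mul, hc] at h
      convert! h using 3 <;> ring
    constructor
    · intro x
      constructor
      · intro hx
        refine ⟨hhalf x hx, hint j _ ?_⟩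
        simpa using sub_mem hx (hhalfΛ x (hhalf x hx))
      · rintro ⟨hx, hs⟩
        have h := hhalfΛ x hx
        obtain ⟨c, hc⟩ := mem_intReal.1 hs
        have h' := hzs j 1 c (hsingle j)
        rw [mul_one, hc] at h'
        simpa using add_mem h h'
    · rintro rfl
      exact hij (Subsingleton.elim i j)

/-- In length two the repetition code and the even-weight code are the same, which is why the plane
has no third class. -/
theorem isBodyCentered_iff_isHalfEven (x : Fin 2 → ℝ) : IsBodyCentered x ↔ IsHalfEven x := by
  simp only [IsBodyCentered, IsHalfEven, Fin.forall_fin_two, Fin.sum_univ_two]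
  have h1 : (1 : ℝ) ∈ intReal := by simpa using intCast_mem_intReal 1
  constructor
  · rintro (⟨h₀, h₁⟩ | ⟨h₀, h₁⟩)
    · exact ⟨⟨two_mul_mem_intReal h₀, two_mul_mem_intReal h₁⟩, add_mem h₀ h₁⟩
    · refine ⟨⟨?_, ?_⟩, ?_⟩
      · convert! add_mem (two_mul_mem_intReal h₀) h1 using 1; ring
      · convert! add_mem (two_mul_mem_intReal h₁) h1 using 1; ring
      · convert! add_mem (add_mem h₀ h₁) h1 using 1; ring
  · rintro ⟨⟨h₀, h₁⟩, hs⟩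
    rcases half_cases h₀ with h | h
    · exact Or.inl ⟨h, by simpa using sub_mem hs h⟩
    · refine Or.inr ⟨h, ?_⟩
      convert! sub_mem (sub_mem hs h) h1 using 1; ring

end InvariantLattices

/-! ### Passing between lattice cubes and lattices around the unit cube. -/

section Cubes

variable {n : ℕ}

local notation "𝔼" => EuclideanSpace ℝ (Fin n)

/-- The linear coordinates on `ℝⁿ` given by a linearly independent family. -/
noncomputable def coordEquiv (w : Fin n → 𝔼) (hw : LinearIndependent ℝ w) :
    (Fin n → ℝ) ≃ₗ[ℝ] 𝔼 :=
  (basisOfLinearIndependentOfCardEqFinrank' w hw (by simp)).equivFun.symm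

theorem coordEquiv_apply (w : Fin n → 𝔼) (hw : LinearIndependent ℝ w) (x : Fin n → ℝ) :
    coordEquiv w hw x = ∑ i, x i • w i := by
  simp [coordEquiv, Module.Basis.equivFun_symm_apply]

theorem coordEquiv_image_Icc (w : Fin n → 𝔼) (hw : LinearIndependent ℝ w) :
    coordEquiv w hw '' Set.Icc 0 1 = parallelepiped w :=
  Set.image_congr fun x _ => coordEquiv_apply w hw x

theorem isLatticePolytope_parallelepiped (L : Submodule ℤ 𝔼) (w : Fin n → 𝔼)
    (hw : ∀ i, w i ∈ L) : IsLatticePolytope L (parallelepiped w) := by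
  classical
  have hfin : (∑ i, {(0 : 𝔼), w i} : Set 𝔼).Finite :=
    Set.Finite.subset (Set.finite_range fun s : Finset (Fin n) => ∑ i ∈ s, w i) (by
      intro x hx
      obtain ⟨g, hg, rfl⟩ := Set.mem_finsetSum _ _ _ |>.1 hx
      refine ⟨Finset.univ.filter fun i => g i ≠ 0, ?_⟩
      simp only [Finset.sum_filter]
      refine Finset.sum_congr rfl fun i _ => ?_
      have : g i = 0 ∨ g i = w i := by simpa using hg (Finset.mem_univ i)
      rcases this with h | h
      · simp [h]
      · by_cases h0 : g i = 0
        · simp [h0]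
        · simp [h0, ← h])
  have hmem : ∀ x ∈ (∑ i, {(0 : 𝔼), w i} : Set 𝔼), x ∈ L := by
    intro x hx
    obtain ⟨g, hg, rfl⟩ := Set.mem_finsetSum _ _ _ |>.1 hx
    refine sum_mem fun i _ => ?_
    have : g i = 0 ∨ g i = w i := by simpa using hg (Finset.mem_univ i)
    rcases this with h | h <;> rw [h]
    · exact zero_mem _
    · exact hw i
  refine ⟨⟨hfin.toFinset, ?_, ?_⟩, ?_⟩
  · refine ⟨0, hfin.mem_toFinset.2 ?_⟩
    exact (Set.mem_finsetSum _ _ _).2 ⟨fun _ => 0, fun {i} _ => by simp, by simp⟩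
  · rw [hfin.coe_toFinset, parallelepiped_eq_convexHull]
  · intro x hx
    rw [parallelepiped_eq_convexHull] at hx
    exact hmem x (extremePoints_convexHull_subset hx)

theorem isLatticeRegular_parallelepiped {L : Submodule ℤ 𝔼} {w : Fin n → 𝔼}
    (hw : LinearIndependent ℝ w) {Λ : (Fin n → ℝ) → Prop}
    (hΛ : ∀ x, ∑ i, x i • w i ∈ L ↔ Λ x)
    (hsymm : ∀ τ ε hε x, Λ x → Λ (cubeSymm τ ε hε x)) (hsingle : ∀ i, w i ∈ L) :
    IsLatticeRegular L (parallelepiped w) := by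
  refine ⟨isLatticePolytope_parallelepiped L w hsingle, ?_⟩
  have h := (flagTransitive_Icc (Λ := {x | Λ x}) hsymm).image (coordEquiv w hw).toAffineEquiv
  have h₁ : (coordEquiv w hw).toAffineEquiv '' {x | Λ x} = L := by
    ext y
    obtain ⟨x, rfl⟩ := (coordEquiv w hw).surjective y
    rw [SetLike.mem_coe, coordEquiv_apply, hΛ, ← coordEquiv_apply w hw]
    exact (coordEquiv w hw).injective.mem_set_image
  have h₂ : (coordEquiv w hw).toAffineEquiv '' Set.Icc 0 1 = parallelepiped w :=
    coordEquiv_image_Icc w hw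
  rw [h₁, h₂] at h
  exact h

theorem image_constVAdd_neg (p : 𝔼) (S : Set 𝔼) :
    AffineEquiv.constVAdd ℝ 𝔼 (-p) '' (p +ᵥ S) = S := by
  rw [← Set.image_vadd, Set.image_image]
  simp

theorem isLatticeAffine_constVAdd {L : Submodule ℤ 𝔼} {p : 𝔼} (hp : p ∈ L) :
    IsLatticeAffine L (AffineEquiv.constVAdd ℝ 𝔼 p) := by
  ext y
  constructor
  · rintro ⟨x, hx, rfl⟩
    exact add_mem hp hx
  · intro hy
    exact ⟨y - p, sub_mem hy hp, by simp⟩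

/-- The linear map `vᵢ ↦ wᵢ` preserves `L`, because lattice points satisfy the same condition `Λ` in
both coordinate systems. -/
theorem latticeCongruent_parallelepiped {L : Submodule ℤ 𝔼} {v w : Fin n → 𝔼}
    (hv : LinearIndependent ℝ v) (hw : LinearIndependent ℝ w) {Λ : (Fin n → ℝ) → Prop}
    (hvΛ : ∀ x, ∑ i, x i • v i ∈ L ↔ Λ x) (hwΛ : ∀ x, ∑ i, x i • w i ∈ L ↔ Λ x)
    {p : 𝔼} (hp : p ∈ L) :
    LatticeCongruent L (p +ᵥ parallelepiped v) (parallelepiped w) := by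
  set g : 𝔼 ≃ᵃ[ℝ] 𝔼 := ((coordEquiv v hv).symm.trans (coordEquiv w hw)).toAffineEquiv with hg
  have hgv : ∀ x, g (coordEquiv v hv x) = coordEquiv w hw x := fun x => by simp [hg]
  have hcomp : ∀ S, ((AffineEquiv.constVAdd ℝ 𝔼 (-p)).trans g) '' S =
      g '' (AffineEquiv.constVAdd ℝ 𝔼 (-p) '' S) := fun S => by
    rw [Set.image_image]; rfl
  refine ⟨(AffineEquiv.constVAdd ℝ 𝔼 (-p)).trans g, ?_, ?_⟩
  · rw [IsLatticeAffine, hcomp, isLatticeAffine_constVAdd (neg_mem hp)]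
    ext y
    constructor
    · rintro ⟨z, hz, rfl⟩
      obtain ⟨x, rfl⟩ := (coordEquiv v hv).surjective z
      rw [SetLike.mem_coe, coordEquiv_apply, hvΛ] at hz
      rw [hgv, SetLike.mem_coe, coordEquiv_apply, hwΛ]
      exact hz
    · intro hy
      obtain ⟨x, rfl⟩ := (coordEquiv w hw).surjective y
      rw [SetLike.mem_coe, coordEquiv_apply, hwΛ] at hy
      refine ⟨coordEquiv v hv x, ?_, hgv x⟩
      rw [SetLike.mem_coe, coordEquiv_apply, hvΛ]
      exact hy
  · rw [hcomp, image_constVAdd_neg, ← coordEquiv_image_Icc v hv, Set.image_image,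
      ← coordEquiv_image_Icc w hw]
    exact Set.image_congr fun x _ => hgv x

theorem not_isElementary_of_div_mem {L : Submodule ℤ 𝔼} {v : Fin n → 𝔼} {p : 𝔼} (hp : p ∈ L)
    {q : ℕ} (hq : 1 < q) (h : ∀ i, (q : ℝ)⁻¹ • v i ∈ L) :
    ¬ IsElementary L (p +ᵥ parallelepiped v) := by
  rintro ⟨-, hel⟩
  have hq0 : (q : ℝ) ≠ 0 := by positivity
  refine hel q hq (parallelepiped fun i => (q : ℝ)⁻¹ • v i)
    (isLatticePolytope_parallelepiped L _ h)
    ⟨AffineEquiv.constVAdd ℝ 𝔼 (-p), isLatticeAffine_constVAdd (neg_mem hp), ?_⟩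
  rw [image_constVAdd_neg, parallelepiped, parallelepiped, ← Set.image_smul, Set.image_image]
  refine Set.image_congr fun x _ => ?_
  rw [Finset.smul_sum]
  refine Finset.sum_congr rfl fun i _ => ?_
  rw [smul_comm (x i), smul_inv_smul₀ hq0]

theorem mem_lattice_iff (e : Module.Basis (Fin n) ℝ 𝔼) (x : 𝔼) :
    x ∈ lattice e ↔ ∀ i, e.repr x i ∈ intReal := by
  rw [lattice, Module.Basis.mem_span_iff_repr_mem]
  simp [mem_intReal]

/-- The coordinates of the lattice with respect to the edges of an elementary lattice-regular
cube. -/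
theorem coordinates_of_isElementary (e : Module.Basis (Fin n) ℝ 𝔼) {p : 𝔼} (hp : p ∈ lattice e)
    {v : Fin n → 𝔼} (hvL : ∀ i, v i ∈ lattice e) (hv : LinearIndependent ℝ v)
    (hel : IsElementary (lattice e) (p +ᵥ parallelepiped v))
    (hreg : IsLatticeRegular (lattice e) (p +ᵥ parallelepiped v)) :
    (∀ x : Fin n → ℝ, ∑ i, x i • v i ∈ lattice e ↔ IsIntegral x) ∨
      ((∀ x : Fin n → ℝ, ∑ i, x i • v i ∈ lattice e ↔ IsBodyCentered x) ∧ n ≠ 1) ∨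
      ((∀ x : Fin n → ℝ, ∑ i, x i • v i ∈ lattice e ↔ IsHalfEven x) ∧ n ≠ 1) := by
  set L := lattice e with hL
  set Λ : AddSubgroup (Fin n → ℝ) :=
    L.toAddSubgroup.comap (coordEquiv v hv).toLinearMap.toAddMonoidHom with hΛ
  have hmem : ∀ x, x ∈ Λ ↔ ∑ i, x i • v i ∈ L := fun x => by
    rw [← coordEquiv_apply v hv]; rfl
  have hms : ∀ i a, Pi.single i a ∈ Λ ↔ a • v i ∈ L := fun i a => by
    rw [hmem]
    simp [Pi.single_apply]
  have hsymm : ∀ τ ε hε, ∀ x ∈ Λ, cubeSymm τ ε hε x ∈ Λ := by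
    set A : (Fin n → ℝ) ≃ᵃ[ℝ] 𝔼 :=
      (coordEquiv v hv).toAffineEquiv.trans (AffineEquiv.constVAdd ℝ 𝔼 p) with hA
    have hAapp : ∀ x, A x = p + coordEquiv v hv x := fun x => rfl
    have hAI : A '' Set.Icc 0 1 = p +ᵥ parallelepiped v := by
      rw [← coordEquiv_image_Icc v hv, ← Set.image_vadd, Set.image_image]
      rfl
    have hAΛ : A '' Λ = L := by
      ext y
      obtain ⟨x, rfl⟩ := A.surjective y
      rw [A.injective.mem_set_image, SetLike.mem_coe, SetLike.mem_coe, hAapp, hmem,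
        ← coordEquiv_apply v hv]
      exact (L.add_mem_iff_right hp).symm
    have hft : FlagTransitive (L : Set 𝔼) (p +ᵥ parallelepiped v) := hreg.2
    have h := hft.image A.symm
    rw [← hAI, ← hAΛ, Set.image_image, Set.image_image] at h
    simp only [AffineEquiv.symm_apply_apply, Set.image_id'] at h
    intro τ ε hε x hx
    have := h.cubeSymm_image τ hε
    rw [← SetLike.mem_coe, ← this]
    exact ⟨x, hx, rfl⟩
  have hsingle : ∀ i, Pi.single i 1 ∈ Λ := fun i => by rw [hms, one_smul]; exact hvL i
  have hperm : ∀ (τ : Equiv.Perm (Fin n)), ∀ x ∈ Λ, (fun i => x (τ i)) ∈ Λ := by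
    intro τ x hx
    have := hsymm τ.symm 0 isVertex_zero x hx
    convert! this using 1
    ext i
    simp [cubeSymm_apply]
  refine invariant_lattice_trichotomy Λ hsingle hperm ?_ ?_ |>.imp (fun h x => ?_)
    (Or.imp (fun h => ⟨fun x => ?_, h.2⟩) (fun h => ⟨fun x => ?_, h.2⟩))
  · intro i x hx
    have hvert : IsVertex (Pi.single i 1 : Fin n → ℝ) := fun j => by
      by_cases hj : j = i
      · subst hj; simp
      · simp [hj]
    -- Reflecting `xᵢ` to `1 - xᵢ` and subtracting gives `(2xᵢ - 1)eᵢ`; adding `eᵢ` removes the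
    -- offset.
    have h := add_mem (sub_mem hx (hsymm (Equiv.refl _) _ hvert x hx)) (hsingle i)
    convert! h using 1
    ext j
    by_cases hj : j = i
    · subst hj; simp [cubeSymm_apply]; ring
    · simp [hj, cubeSymm_apply]
  · intro i a ha
    -- Comparing a nonzero integer coordinate of `vᵢ` with the same coordinate of `a vᵢ` shows that
    -- `a` is rational.
    obtain ⟨m, hm⟩ : ∃ m, e.repr (v i) m ≠ 0 := by
      by_contra! h0
      exact hv.ne_zero i (e.ext_elem (by simpa using h0))
    obtain ⟨c, hc⟩ := mem_intReal.1 ((mem_lattice_iff e _).1 (hvL i) m)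
    obtain ⟨d, hd⟩ := mem_intReal.1 ((mem_lattice_iff e _).1 ((hms i a).1 ha) m)
    rw [← hc] at hm
    rw [map_smul, Finsupp.smul_apply, ← hc, smul_eq_mul] at hd
    set r : ℚ := (d : ℚ) / c with hr
    have har : a = (r : ℝ) := by
      rw [hr]; push_cast; field_simp; exact hd.symm
    have hden : (r.den : ℝ) ≠ 0 := by exact_mod_cast r.den_ne_zero
    have hnum : a * r.den = r.num := by
      rw [har]; exact_mod_cast Rat.mul_den_eq_num r
    -- By Bézout `1/den` is an integer combination of `a` and `1`. Permutations then divide every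
    -- edge by `den`, and being elementary forces `den = 1`.
    have hbez : ∃ s t : ℤ, s * r.num + t * r.den = 1 := by
      have := Rat.isCoprime_num_den r
      exact this
    obtain ⟨s, t, hst⟩ := hbez
    have hst' : (s : ℝ) * r.num + t * r.den = 1 := by exact_mod_cast hst
    have hinv : (r.den : ℝ)⁻¹ = s * a + t := by
      field_simp
      rw [← hst', ← hnum]; ring
    have hone : Pi.single i (r.den : ℝ)⁻¹ ∈ Λ := by
      have h₁ := Λ.zsmul_mem ha s
      have h₂ := Λ.zsmul_mem (hsingle i) t
      rw [← Pi.single_smul, zsmul_eq_mul] at h₁ h₂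
      rw [hinv, Pi.single_add]
      simpa using add_mem h₁ h₂
    have hall : ∀ j, (r.den : ℝ)⁻¹ • v j ∈ L := fun j => by
      rw [← hms]
      convert! hperm (Equiv.swap i j) _ hone using 1
      ext m
      have h₁ : Equiv.swap i j m = i ↔ m = j := by
        rw [Equiv.swap_apply_eq_iff, Equiv.swap_apply_left]
      simp [Pi.single_apply, h₁]
    have hden1 : r.den = 1 := by
      by_contra hne
      have := r.den_pos
      exact not_isElementary_of_div_mem hp (by omega) hall hel
    rw [hden1] at hnum
    exact mem_intReal.2 ⟨r.num, by simpa using hnum.symm⟩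
  · rw [← hmem]; exact h x
  · rw [← hmem]; exact h.1 x
  · rw [← hmem]; exact h.1 x

end Cubes

open MeasureTheory

/-! ### Euclidean volume of the standard simplex. -/

section SimplexVolume

variable {n : ℕ}

/-- The simplex spanned by the origin and the standard basis vectors. -/
def cornerSimplex (n : ℕ) : Set (Fin n → ℝ) := {x | (∀ i, 0 ≤ x i) ∧ ∑ i, x i ≤ 1}

theorem volume_sum_abs_le_one (hn : n ≠ 0) :
    volume {x : Fin n → ℝ | ∑ i, |x i| ≤ 1} = ENNReal.ofReal (2 ^ n / n.factorial) := by
  have : Nonempty (Fin n) := ⟨⟨0, Nat.pos_of_ne_zero hn⟩⟩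
  have h := volume_sum_rpow_le (Fin n) (p := 1) le_rfl 1
  have h2 : Real.Gamma (1 + 1) = 1 := by
    rw [Real.Gamma_add_one one_ne_zero, Real.Gamma_one, one_mul]
  simpa [h2, Real.Gamma_nat_eq_factorial] using h

theorem measurableSet_cornerSimplex : MeasurableSet (cornerSimplex n) := by
  apply IsClosed.measurableSet
  simp only [cornerSimplex, Set.ofPred_and, Set.ofPred_forall]
  exact (isClosed_iInter fun i => isClosed_le continuous_const (continuous_apply i)).inter
    (isClosed_le (by fun_prop) continuous_const)

/-- The `2ⁿ` sign changes of the simplex tile the cross-polytope, the unit ball of the `ℓ¹` norm,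
whose volume is `2ⁿ/n!`. -/
theorem volume_real_cornerSimplex (hn : n ≠ 0) :
    volume.real (cornerSimplex n) = 1 / n.factorial := by
  set f : (Fin n → ℤˣ) → (Fin n → ℝ) →ₗ[ℝ] (Fin n → ℝ) := fun s =>
    Matrix.toLin' (Matrix.diagonal fun i => ((s i : ℤ) : ℝ)) with hf
  have hfa : ∀ s x i, f s x i = ((s i : ℤ) : ℝ) * x i := fun s x i => by
    simp [hf, Matrix.mulVec_diagonal]
  have hs1 : ∀ u : ℤˣ, |((u : ℤ) : ℝ)| = 1 := fun u => by
    rcases Int.units_eq_one_or u with h | h <;> simp [h]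
  have hdet : ∀ s, |LinearMap.det (f s)| = 1 := fun s => by
    simp [hf, LinearMap.det_toLin', Matrix.det_diagonal, Finset.abs_prod, hs1]
  have hvol : ∀ s, volume (f s ⁻¹' cornerSimplex n) = volume (cornerSimplex n) := fun s => by
    have h0 : LinearMap.det (f s) ≠ 0 := fun h => by simpa [h] using hdet s
    rw [Measure.addHaar_preimage_linearMap _ h0, abs_inv, hdet]
    simp
  have hunion : (⋃ s, f s ⁻¹' cornerSimplex n) = {x : Fin n → ℝ | ∑ i, |x i| ≤ 1} := by
    ext x
    simp only [Set.mem_iUnion, Set.mem_preimage, cornerSimplex, Set.mem_ofPred_eq, hfa]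
    constructor
    · rintro ⟨s, h₀, h₁⟩
      have h : ∀ i, |x i| = ((s i : ℤ) : ℝ) * x i := fun i => by
        rw [← abs_of_nonneg (h₀ i), abs_mul, hs1, one_mul]
      simpa only [h] using h₁
    · intro hx
      have key : ∀ i, (((if 0 ≤ x i then 1 else -1 : ℤˣ) : ℤ) : ℝ) * x i = |x i| := fun i => by
        split_ifs with h
        · simp [abs_of_nonneg h]
        · simp [abs_of_neg (not_le.1 h)]
      refine ⟨fun i => if 0 ≤ x i then 1 else -1, fun i => ?_, ?_⟩
      · rw [key]; exact abs_nonneg _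
      · simpa only [key] using hx
  have hdisj : Pairwise (Function.onFun (AEDisjoint volume) fun s => f s ⁻¹' cornerSimplex n) := by
    intro s t hst
    obtain ⟨i, hi⟩ := Function.ne_iff.1 hst
    -- Two copies whose signs differ at `i` meet only inside a coordinate hyperplane.
    refine measure_mono_null (t := {x : Fin n → ℝ | x i = 0}) ?_
      (Measure.pi_hyperplane _ i 0)
    rintro x ⟨h₁, h₂⟩
    have h₁ := h₁.1 i
    have h₂ := h₂.1 i
    rw [hfa] at h₁ h₂
    show x i = 0
    rcases Int.units_eq_one_or (s i) with h | h <;>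
      rcases Int.units_eq_one_or (t i) with h' | h' <;>
      simp only [h, h', ne_eq, not_true_eq_false] at hi h₁ h₂ <;> simp at h₁ h₂ <;> linarith
  have hmeas : ∀ s, NullMeasurableSet (f s ⁻¹' cornerSimplex n) volume := fun s =>
    ((LinearMap.continuous_of_finiteDimensional (f s)).measurable
      measurableSet_cornerSimplex).nullMeasurableSet
  have h := measure_iUnion₀ hdisj hmeas
  rw [hunion, volume_sum_abs_le_one hn, tsum_fintype] at h
  simp only [hvol, Finset.sum_const, Finset.card_univ, Fintype.card_pi, Finset.prod_const,
    Fintype.card_fin, Fintype.card_units_int, nsmul_eq_mul] at h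
  have h' := congrArg ENNReal.toReal h
  rw [ENNReal.toReal_ofReal (by positivity), ENNReal.toReal_mul] at h'
  have h2 : (2 : ℝ) ^ n ≠ 0 := by positivity
  have h3 : (2 : ℝ) ^ n * (volume (cornerSimplex n)).toReal = 2 ^ n * (1 / n.factorial) := by
    rw [mul_one_div, h']; simp
  exact mul_left_cancel₀ h2 h3

/-- The vertices of `cornerSimplex`. -/
def cornerVertex (n : ℕ) : Fin (n + 1) → Fin n → ℝ := Fin.cons 0 fun i => Pi.single i 1

theorem convexHull_cornerVertex :
    convexHull ℝ (Set.range (cornerVertex n)) = cornerSimplex n := by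
  apply Set.Subset.antisymm
  · apply convexHull_min
    · rintro _ ⟨k, rfl⟩
      refine Fin.cases ?_ (fun i => ?_) k
      · simp [cornerVertex, cornerSimplex]
      · refine ⟨fun j => ?_, ?_⟩
        · simp only [cornerVertex, Fin.cons_succ, Pi.single_apply]
          split_ifs <;> norm_num
        · simp [cornerVertex]
    · intro x hx y hy a b ha hb hab
      refine ⟨fun i => ?_, ?_⟩
      · have := hx.1 i
        have := hy.1 i
        simp only [Pi.add_apply, Pi.smul_apply, smul_eq_mul]
        positivity
      · simp only [Pi.add_apply, Pi.smul_apply, smul_eq_mul, Finset.sum_add_distrib,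
          ← Finset.mul_sum]
        nlinarith [hx.2, hy.2]
  · rintro x ⟨hx, hx1⟩
    have h := (convex_convexHull ℝ (Set.range (cornerVertex n))).sum_mem
      (t := Finset.univ) (w := Fin.cons (1 - ∑ i, x i) x) (z := cornerVertex n) ?_ ?_
      (fun i _ => subset_convexHull ℝ _ ⟨i, rfl⟩)
    · convert! h using 1
      rw [Fin.sum_univ_succ]
      ext j
      simp [cornerVertex, Finset.sum_apply, Pi.single_apply]
    · intro i _
      refine Fin.cases ?_ (fun j => ?_) i
      · simpa using hx1
      · simpa using hx j
    · simp [Fin.sum_univ_succ]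

theorem affineIndependent_cornerVertex : AffineIndependent ℝ (cornerVertex n) := by
  rw [affineIndependent_iff_linearIndependent_vsub ℝ _ 0]
  have h : LinearIndependent ℝ (fun i : Fin n => (Pi.single i 1 : Fin n → ℝ)) :=
    Pi.linearIndependent_single_one (Fin n) ℝ
  convert! h.comp (fun i : {x : Fin (n + 1) // x ≠ 0} => i.1.pred i.2) ?_ using 1
  · ext ⟨i, hi⟩ j
    obtain ⟨k, rfl⟩ := Fin.exists_succ_eq.2 hi
    simp [cornerVertex]
  · rintro ⟨i, hi⟩ ⟨j, hj⟩ hij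
    exact Subtype.ext (Fin.pred_inj.1 hij)

end SimplexVolume

/-! ### Lattice volume as a determinant, and its invariance. -/

section LatticeVolume

variable {n : ℕ}

local notation "𝔼" => EuclideanSpace ℝ (Fin n)

/-- The constant is the volume of the fundamental cell of `e`. Only its positivity and its
independence of `w` are needed, since it cancels in every comparison. -/
theorem exists_volume_real_coordEquiv_image (e : Module.Basis (Fin n) ℝ 𝔼) :
    ∃ c : ℝ, 0 < c ∧ ∀ (w : Fin n → 𝔼) (hw : LinearIndependent ℝ w) (p : 𝔼)
      (S : Set (Fin n → ℝ)),
      volume.real (p +ᵥ coordEquiv w hw '' S) = c * |e.det w| * volume.real S := by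
  set ι : 𝔼 ≃ₗ[ℝ] (Fin n → ℝ) := WithLp.linearEquiv 2 ℝ (Fin n → ℝ) with hι
  have hιvol : ∀ S : Set 𝔼, volume (ι '' S) = volume S := fun S => by
    have := (PiLp.volume_preserving_toLp (Fin n)).measure_preimage_equiv
      (f := MeasurableEquiv.toLp 2 (Fin n → ℝ)) S
    rw [← this]
    congr 1
    exact ι.toEquiv.image_eq_preimage_symm S
  refine ⟨|LinearMap.det (e.equivFun.symm.trans ι).toLinearMap|, ?_, ?_⟩
  · rw [abs_pos]
    exact (LinearEquiv.isUnit_det' _).ne_zero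
  intro w hw p S
  have hdet : LinearMap.det ((coordEquiv w hw).trans e.equivFun).toLinearMap = e.det w := by
    rw [Module.Basis.det_apply, ← LinearMap.det_toMatrix']
    congr 1
    ext i j
    simp [LinearMap.toMatrix'_apply, coordEquiv_apply, Module.Basis.toMatrix_apply,
      Pi.single_apply]
  have hcomp : ι '' (coordEquiv w hw '' S) = ((e.equivFun.symm.trans ι).toLinearMap ∘ₗ
      ((coordEquiv w hw).trans e.equivFun).toLinearMap) '' S := by
    rw [Set.image_image]
    refine Set.image_congr fun x _ => ?_
    simp
  rw [measureReal_def, measure_vadd, ← hιvol, hcomp, Measure.addHaar_image_linearMap,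
    LinearMap.det_comp, hdet, ENNReal.toReal_mul, ENNReal.toReal_ofReal (abs_nonneg _), abs_mul]
  rfl

theorem exists_det_eq_intCast (e : Module.Basis (Fin n) ℝ 𝔼) {v : Fin n → 𝔼}
    (hv : ∀ i, v i ∈ lattice e) : ∃ k : ℤ, e.det v = k := by
  have h : ∀ i j, ∃ k : ℤ, (k : ℝ) = e.repr (v j) i := fun i j =>
    mem_intReal.1 ((mem_lattice_iff e _).1 (hv j) i)
  choose M hM using h
  refine ⟨(Matrix.of M).det, ?_⟩
  rw [Module.Basis.det_apply, Int.cast_det]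
  congr 1
  ext i j
  simp [Module.Basis.toMatrix_apply, hM]

theorem det_ne_zero (e : Module.Basis (Fin n) ℝ 𝔼) {v : Fin n → 𝔼}
    (hv : LinearIndependent ℝ v) : e.det v ≠ 0 := by
  have := (Module.Basis.is_basis_iff_det e (v := v)).1
    ⟨hv, hv.span_eq_top_of_card_eq_finrank' (by simp)⟩
  exact this.ne_zero

theorem linearIndependent_of_det_ne_zero (e : Module.Basis (Fin n) ℝ 𝔼) {v : Fin n → 𝔼}
    (h : e.det v ≠ 0) : LinearIndependent ℝ v :=
  ((Module.Basis.is_basis_iff_det e (v := v)).2 h.isUnit).1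

/-- The edge vectors of a nondegenerate lattice simplex have a nonzero integer determinant, so its
volume is at least `c/n!`; the simplex on `0` and the basis attains this. -/
theorem hasLatticeVolume_parallelepiped (hn : n ≠ 0) (e : Module.Basis (Fin n) ℝ 𝔼)
    {v : Fin n → 𝔼} (hv : LinearIndependent ℝ v) (p : 𝔼) :
    HasLatticeVolume (lattice e) (p +ᵥ parallelepiped v) (|e.det v| * n.factorial) := by
  obtain ⟨c, hc, hvol⟩ := exists_volume_real_coordEquiv_image e
  have hfac : (0 : ℝ) < n.factorial := by exact_mod_cast n.factorial_pos
  have himg : ∀ (w : Fin n → 𝔼) (hw : LinearIndependent ℝ w) (q : 𝔼),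
      convexHull ℝ (Set.range fun k => q + coordEquiv w hw (cornerVertex n k)) =
        q +ᵥ coordEquiv w hw '' cornerSimplex n := by
    intro w hw q
    set A : (Fin n → ℝ) ≃ᵃ[ℝ] 𝔼 :=
      (coordEquiv w hw).toAffineEquiv.trans (AffineEquiv.constVAdd ℝ 𝔼 q) with hA
    have h := AffineMap.image_convexHull (A : (Fin n → ℝ) →ᵃ[ℝ] 𝔼) (Set.range (cornerVertex n))
    rw [convexHull_cornerVertex, ← Set.range_comp] at h
    rw [← Set.image_vadd, Set.image_image]
    exact h.symm
  refine ⟨c * (1 / n.factorial), ⟨?_, ?_⟩, ?_⟩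
  · refine ⟨fun k => 0 + coordEquiv e e.linearIndependent (cornerVertex n k), ?_, ?_, ?_⟩
    · intro k
      refine Fin.cases ?_ (fun i => ?_) k
      · simp [cornerVertex]
      · simp only [zero_add, cornerVertex, Fin.cons_succ, coordEquiv_apply]
        simp only [Pi.single_apply, ite_smul, one_smul, zero_smul, Finset.sum_ite_eq',
          Finset.mem_univ, if_true]
        exact Submodule.subset_span ⟨i, rfl⟩
    · simp only [zero_add]
      exact affineIndependent_cornerVertex.map'
        (coordEquiv e e.linearIndependent).toAffineEquiv.toAffineMap
        (coordEquiv e e.linearIndependent).injective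
    · rw [himg, hvol, volume_real_cornerSimplex hn, e.det_self]
      simp
  · rintro V ⟨s, hsL, hs, rfl⟩
    set w : Fin n → 𝔼 := fun i => s i.succ - s 0 with hwdef
    have hw : LinearIndependent ℝ w :=
      ((affineIndependent_iff_linearIndependent_vsub ℝ s 0).1 hs).comp
        (fun i : Fin n => (⟨i.succ, Fin.succ_ne_zero i⟩ : {x : Fin (n + 1) // x ≠ 0}))
        (fun i j hij => Fin.succ_injective _ (congrArg Subtype.val hij))
    have hsw : s = fun k => s 0 + coordEquiv w hw (cornerVertex n k) := by
      ext1 k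
      refine Fin.cases ?_ (fun i => ?_) k
      · simp [cornerVertex]
      · simp [cornerVertex, coordEquiv_apply, Pi.single_apply, hwdef]
    rw [hsw, himg, hvol, volume_real_cornerSimplex hn]
    obtain ⟨k, hk⟩ := exists_det_eq_intCast e (v := w) fun i => sub_mem (hsL _) (hsL _)
    have hk0 : k ≠ 0 := fun h => det_ne_zero e hw (by rw [hk, h]; simp)
    have h1 : (1 : ℝ) ≤ |e.det w| := by
      rw [hk]
      exact_mod_cast Int.one_le_abs hk0
    gcongr
    nlinarith
  · rw [← coordEquiv_image_Icc v hv, hvol]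
    have : volume.real (Set.Icc (0 : Fin n → ℝ) 1) = 1 := by
      simp [measureReal_def, Real.volume_Icc_pi]
    rw [this]
    field_simp

/-- The linear parts of a lattice-affine map and of its inverse have integer determinants with
product `1`, hence `±1`. -/
theorem volume_real_eq_of_latticeCongruent (e : Module.Basis (Fin n) ℝ 𝔼) {P Q : Set 𝔼}
    (h : LatticeCongruent (lattice e) P Q) : volume.real P = volume.real Q := by
  have hint : ∀ f : 𝔼 ≃ᵃ[ℝ] 𝔼, IsLatticeAffine (lattice e) f →
      ∃ k : ℤ, LinearMap.det f.linear.toLinearMap = k := by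
    intro f hf
    have hmaps : ∀ x ∈ lattice e, f x ∈ lattice e := fun x hx => by
      rw [← SetLike.mem_coe, ← hf]; exact ⟨x, hx, rfl⟩
    obtain ⟨k, hk⟩ := exists_det_eq_intCast e (v := f.linear.toLinearMap ∘ e) fun i => by
      have : f.linear (e i) = f (e i) - f 0 := by
        have := f.map_vadd 0 (e i)
        simp only [vadd_eq_add, add_zero] at this
        rw [this]; simp
      simp only [Function.comp_apply, LinearEquiv.coe_coe, this]
      exact sub_mem (hmaps _ (Submodule.subset_span ⟨i, rfl⟩)) (hmaps _ (zero_mem _))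
    refine ⟨k, ?_⟩
    rw [Module.Basis.det_comp, e.det_self, mul_one] at hk
    exact hk
  obtain ⟨f, hf, rfl⟩ := h
  have hf' : IsLatticeAffine (lattice e) f.symm := by
    rw [IsLatticeAffine]
    nth_rewrite 1 [← hf]
    rw [Set.image_image]
    simp
  obtain ⟨k, hk⟩ := hint f hf
  obtain ⟨k', hk'⟩ := hint f.symm hf'
  have hprod : k * k' = 1 := by
    have : LinearMap.det f.linear.toLinearMap * LinearMap.det f.symm.linear.toLinearMap = 1 := by
      rw [← LinearMap.det_comp]
      convert! LinearMap.det_id using 2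
      ext1 x
      simp
    rw [hk, hk'] at this
    exact_mod_cast this
  have habs : |LinearMap.det f.linear.toLinearMap| = 1 := by
    rw [hk]
    rcases Int.eq_one_or_neg_one_of_mul_eq_one hprod with h | h <;> simp [h]
  have himg : f '' P = f 0 +ᵥ f.linear.toLinearMap '' P := by
    rw [← Set.image_vadd, Set.image_image]
    refine Set.image_congr fun x _ => ?_
    have := f.map_vadd 0 x
    simp only [vadd_eq_add, add_zero] at this
    rw [this, vadd_eq_add, add_comm]; rfl
  rw [himg, measureReal_def, measureReal_def, measure_vadd, Measure.addHaar_image_linearMap, habs]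
  simp

theorem abs_det_eq_of_latticeCongruent (e : Module.Basis (Fin n) ℝ 𝔼) {v w : Fin n → 𝔼}
    (hv : LinearIndependent ℝ v) (hw : LinearIndependent ℝ w)
    (h : LatticeCongruent (lattice e) (parallelepiped v) (parallelepiped w)) :
    |e.det v| = |e.det w| := by
  obtain ⟨c, hc, hvol⟩ := exists_volume_real_coordEquiv_image e
  have h1 : volume.real (Set.Icc (0 : Fin n → ℝ) 1) = 1 := by
    simp [measureReal_def, Real.volume_Icc_pi]
  have h := volume_real_eq_of_latticeCongruent e h
  rw [← coordEquiv_image_Icc v hv, ← coordEquiv_image_Icc w hw,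
    ← zero_vadd 𝔼 (coordEquiv v hv '' _), ← zero_vadd 𝔼 (coordEquiv w hw '' _), hvol, hvol, h1,
    mul_one, mul_one] at h
  exact mul_left_cancel₀ hc.ne' h

end LatticeVolume

/-! ### The three model cubes. -/

section Models

variable {n : ℕ}

local notation "𝔼" => EuclideanSpace ℝ (Fin n)

/-- The edges of `cube₂`. -/
noncomputable def edges₂ (e : Module.Basis (Fin n) ℝ 𝔼) (i : Fin n) : 𝔼 :=
  if (i : ℕ) + 1 = n then (∑ j ∈ Finset.univ.erase i, e j) + (2 : ℝ) • e i else e i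

/-- The edges of `cube₃`. -/
noncomputable def edges₃ (e : Module.Basis (Fin n) ℝ 𝔼) (i : Fin n) : 𝔼 :=
  if (i : ℕ) = 0 then e i else e ⟨0, i.pos⟩ + (2 : ℝ) • e i

theorem repr_edges₂ (e : Module.Basis (Fin n) ℝ 𝔼) (i j : Fin n) :
    e.repr (edges₂ e j) i =
      if (j : ℕ) + 1 = n then (if i = j then 2 else 1) else if i = j then 1 else 0 := by
  rw [edges₂]
  split_ifs with h₁ h₂ h₂
  · subst h₂
    simp [Finsupp.single_apply]
  · simp [Finsupp.single_apply, h₂]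
  · subst h₂; simp
  · simp [Ne.symm h₂]

theorem repr_edges₃ (e : Module.Basis (Fin n) ℝ 𝔼) (i j : Fin n) :
    e.repr (edges₃ e j) i = if (j : ℕ) = 0 then (if (i : ℕ) = 0 then 1 else 0)
      else if (i : ℕ) = 0 then 1 else if i = j then 2 else 0 := by
  rw [edges₃]
  by_cases hj : (j : ℕ) = 0
  · simp only [hj, if_true, Module.Basis.repr_self, Finsupp.single_apply, Fin.ext_iff, eq_comm]
  · have hz : (⟨0, j.pos⟩ : Fin n) = i ↔ (i : ℕ) = 0 := by rw [Fin.ext_iff, eq_comm]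
    simp only [hj, if_false, map_add, map_smul, Module.Basis.repr_self, Finsupp.add_apply,
      Finsupp.smul_apply, Finsupp.single_apply, hz, smul_eq_mul]
    by_cases hi : (i : ℕ) = 0
    · have : j ≠ i := fun h => hj (h ▸ hi)
      simp [hi, this]
    · simp [hi, eq_comm]

theorem det_edges₂ (hn : n ≠ 0) (e : Module.Basis (Fin n) ℝ 𝔼) : e.det (edges₂ e) = 2 := by
  obtain ⟨m, rfl⟩ := Nat.exists_eq_succ_of_ne_zero hn
  rw [Module.Basis.det_apply, Matrix.det_of_isUpperTriangular]
  · simp only [Module.Basis.toMatrix_apply, repr_edges₂]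
    rw [Fin.prod_univ_castSucc, Finset.prod_eq_one]
    · simp
    · intro i _
      simp [i.2.ne]
  · intro i j hij
    have hij : j < i := hij
    rw [Module.Basis.toMatrix_apply, repr_edges₂, if_neg, if_neg hij.ne']
    have := i.2
    have := Fin.lt_def.1 hij
    omega

theorem det_edges₃ (hn : n ≠ 0) (e : Module.Basis (Fin n) ℝ 𝔼) :
    e.det (edges₃ e) = 2 ^ (n - 1) := by
  obtain ⟨m, rfl⟩ := Nat.exists_eq_succ_of_ne_zero hn
  rw [Module.Basis.det_apply, Matrix.det_of_isUpperTriangular]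
  · simp only [Module.Basis.toMatrix_apply, repr_edges₃]
    rw [Fin.prod_univ_succ]
    simp
  · intro i j hij
    have hij : j < i := hij
    have := Fin.lt_def.1 hij
    rw [Module.Basis.toMatrix_apply, repr_edges₃]
    have hi : (i : ℕ) ≠ 0 := by omega
    simp [hi, hij.ne']

theorem sum_mem_lattice_iff (e : Module.Basis (Fin n) ℝ 𝔼) (w : Fin n → 𝔼) (x : Fin n → ℝ) :
    ∑ i, x i • w i ∈ lattice e ↔ ∀ i, ∑ j, x j * e.repr (w j) i ∈ intReal := by
  rw [mem_lattice_iff]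
  simp [Finsupp.finsetSum_apply]

theorem sum_edges₁_mem_iff (e : Module.Basis (Fin n) ℝ 𝔼) (x : Fin n → ℝ) :
    ∑ i, x i • e i ∈ lattice e ↔ IsIntegral x := by
  rw [sum_mem_lattice_iff]
  simp [IsIntegral, Finsupp.single_apply]

/-- In the basis `e` the point has coordinates `xᵢ + xₙ` for `i < n` and `2xₙ`. Their integrality
makes all `xᵢ` integers or all half-odd, according to `xₙ`. -/
theorem sum_edges₂_mem_iff (hn : n ≠ 0) (e : Module.Basis (Fin n) ℝ 𝔼) (x : Fin n → ℝ) :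
    ∑ i, x i • edges₂ e i ∈ lattice e ↔ IsBodyCentered x := by
  obtain ⟨m, rfl⟩ := Nat.exists_eq_succ_of_ne_zero hn
  have h1 : (1 : ℝ) ∈ intReal := by simpa using intCast_mem_intReal 1
  have hlast : ∑ j, x j * e.repr (edges₂ e j) (Fin.last m) = 2 * x (Fin.last m) := by
    simp only [repr_edges₂]
    rw [Fin.sum_univ_castSucc, Finset.sum_eq_zero]
    · simp [mul_comm]
    · intro i _
      simp [i.2.ne, (Fin.castSucc_lt_last i).ne']
  have hcast : ∀ i : Fin m, ∑ j, x j * e.repr (edges₂ e j) i.castSucc =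
      x i.castSucc + x (Fin.last m) := by
    intro i
    simp only [repr_edges₂]
    rw [Fin.sum_univ_castSucc, Finset.sum_eq_single i]
    · simp [i.2.ne, (Fin.castSucc_lt_last i).ne]
    · intro j _ hj
      simp [j.2.ne, Ne.symm hj]
    · simp
  rw [sum_mem_lattice_iff, Fin.forall_fin_succ', hlast]
  simp only [hcast, IsBodyCentered]
  constructor
  · rintro ⟨h, hl⟩
    rcases half_cases hl with hl | hl
    · left
      refine Fin.lastCases hl fun i => ?_
      simpa using sub_mem (h i) hl
    · right
      refine Fin.lastCases hl fun i => ?_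
      convert! sub_mem (sub_mem (h i) hl) h1 using 1
      ring
  · rintro (h | h)
    · exact ⟨fun i => add_mem (h _) (h _), two_mul_mem_intReal (h _)⟩
    · refine ⟨fun i => ?_, ?_⟩
      · convert! add_mem (add_mem (h i.castSucc) (h (Fin.last m))) h1 using 1
        ring
      · convert! add_mem (two_mul_mem_intReal (h (Fin.last m))) h1 using 1
        ring

theorem sum_edges₃_mem_iff (hn : n ≠ 0) (e : Module.Basis (Fin n) ℝ 𝔼) (x : Fin n → ℝ) :
    ∑ i, x i • edges₃ e i ∈ lattice e ↔ IsHalfEven x := by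
  obtain ⟨m, rfl⟩ := Nat.exists_eq_succ_of_ne_zero hn
  have hzero : ∑ j, x j * e.repr (edges₃ e j) 0 = ∑ j, x j := by
    refine Finset.sum_congr rfl fun j _ => ?_
    simp [repr_edges₃]
  have hsucc : ∀ i : Fin m, ∑ j, x j * e.repr (edges₃ e j) i.succ = 2 * x i.succ := by
    intro i
    simp only [repr_edges₃]
    rw [Fin.sum_univ_succ, Finset.sum_eq_single i]
    · simp [mul_comm]
    · intro j _ hj
      simp [Ne.symm hj]
    · simp
  rw [sum_mem_lattice_iff, Fin.forall_fin_succ, hzero]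
  simp only [hsucc, IsHalfEven]
  constructor
  · rintro ⟨hs, h⟩
    refine ⟨Fin.cases ?_ h, hs⟩
    -- The lattice coordinates are `∑ xⱼ` and the doubles of all but the first; doubling the sum
    -- recovers the missing double.
    have h₁ := two_mul_mem_intReal hs
    rw [Fin.sum_univ_succ, mul_add, Finset.mul_sum] at h₁
    simpa using sub_mem h₁ (sum_mem fun i (_ : i ∈ Finset.univ) => h i)
  · rintro ⟨h, hs⟩
    exact ⟨hs, fun i => h _⟩

theorem linearIndependent_edges₂ (hn : n ≠ 0) (e : Module.Basis (Fin n) ℝ 𝔼) :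
    LinearIndependent ℝ (edges₂ e) :=
  linearIndependent_of_det_ne_zero e (by rw [det_edges₂ hn]; norm_num)

theorem linearIndependent_edges₃ (hn : n ≠ 0) (e : Module.Basis (Fin n) ℝ 𝔼) :
    LinearIndependent ℝ (edges₃ e) :=
  linearIndependent_of_det_ne_zero e (by rw [det_edges₃ hn]; positivity)

theorem edges_mem {L : Submodule ℤ 𝔼} {w : Fin n → 𝔼} {Λ : (Fin n → ℝ) → Prop}
    (hΛ : ∀ x, ∑ i, x i • w i ∈ L ↔ Λ x) (h : ∀ i, Λ (Pi.single i 1)) (i : Fin n) : w i ∈ L := by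
  have := (hΛ _).2 (h i)
  simpa [Pi.single_apply] using this

theorem isIntegral_single (i : Fin n) : IsIntegral (Pi.single i 1) := fun j => by
  rw [Pi.single_apply]
  split_ifs
  · simpa using intCast_mem_intReal 1
  · exact zero_mem _

theorem isHalfEven_single (i : Fin n) : IsHalfEven (Pi.single i 1) :=
  ⟨fun j => two_mul_mem_intReal (isIntegral_single i j),
    sum_mem fun j _ => isIntegral_single i j⟩

theorem isLatticeRegular_cube₁ (e : Module.Basis (Fin n) ℝ 𝔼) :
    IsLatticeRegular (lattice e) (cube₁ e) :=
  isLatticeRegular_parallelepiped e.linearIndependent (sum_edges₁_mem_iff e)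
    (fun τ _ hε _ hx => hx.cubeSymm τ hε) (edges_mem (sum_edges₁_mem_iff e) isIntegral_single)

theorem isLatticeRegular_cube₂ (hn : n ≠ 0) (e : Module.Basis (Fin n) ℝ 𝔼) :
    IsLatticeRegular (lattice e) (cube₂ e) :=
  isLatticeRegular_parallelepiped (linearIndependent_edges₂ hn e) (sum_edges₂_mem_iff hn e)
    (fun τ _ hε _ hx => hx.cubeSymm τ hε)
    (edges_mem (sum_edges₂_mem_iff hn e) fun i => Or.inl (isIntegral_single i))

theorem isLatticeRegular_cube₃ (hn : n ≠ 0) (e : Module.Basis (Fin n) ℝ 𝔼) :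
    IsLatticeRegular (lattice e) (cube₃ e) :=
  isLatticeRegular_parallelepiped (linearIndependent_edges₃ hn e) (sum_edges₃_mem_iff hn e)
    (fun τ _ hε _ hx => hx.cubeSymm τ hε)
    (edges_mem (sum_edges₃_mem_iff hn e) isHalfEven_single)

theorem not_latticeCongruent_cube₁_cube₂ (hn : n ≠ 0) (e : Module.Basis (Fin n) ℝ 𝔼) :
    ¬ LatticeCongruent (lattice e) (cube₁ e) (cube₂ e) := fun h => by
  have := abs_det_eq_of_latticeCongruent e e.linearIndependent (linearIndependent_edges₂ hn e) h
  rw [e.det_self, det_edges₂ hn] at this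
  norm_num at this

theorem not_latticeCongruent_cube₁_cube₃ (hn : 2 ≤ n) (e : Module.Basis (Fin n) ℝ 𝔼) :
    ¬ LatticeCongruent (lattice e) (cube₁ e) (cube₃ e) := fun h => by
  have hn0 : n ≠ 0 := by omega
  have := abs_det_eq_of_latticeCongruent e e.linearIndependent (linearIndependent_edges₃ hn0 e) h
  rw [e.det_self, det_edges₃ hn0, abs_one, abs_of_pos (by positivity)] at this
  exact (one_lt_pow₀ (one_lt_two (α := ℝ)) (by omega : n - 1 ≠ 0)).ne this

theorem not_latticeCongruent_cube₂_cube₃ (hn : 3 ≤ n) (e : Module.Basis (Fin n) ℝ 𝔼) :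
    ¬ LatticeCongruent (lattice e) (cube₂ e) (cube₃ e) := fun h => by
  have hn0 : n ≠ 0 := by omega
  have := abs_det_eq_of_latticeCongruent e (linearIndependent_edges₂ hn0 e)
    (linearIndependent_edges₃ hn0 e) h
  rw [det_edges₂ hn0, det_edges₃ hn0, abs_two, abs_of_pos (by positivity)] at this
  have h1 : (2 : ℝ) ^ 1 < 2 ^ (n - 1) := pow_lt_pow_right₀ one_lt_two (by omega)
  linarith

theorem latticeCongruent_of_isElementary (hn : n ≠ 0) (e : Module.Basis (Fin n) ℝ 𝔼) {C : Set 𝔼}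
    (hC : IsLatticeCube (lattice e) C) (hel : IsElementary (lattice e) C)
    (hreg : IsLatticeRegular (lattice e) C) :
    LatticeCongruent (lattice e) C (cube₁ e) ∨
      (LatticeCongruent (lattice e) C (cube₂ e) ∧ n ≠ 1) ∨
      (LatticeCongruent (lattice e) C (cube₃ e) ∧ 3 ≤ n) := by
  obtain ⟨p, hp, v, hvL, hv, rfl⟩ := hC
  rcases coordinates_of_isElementary e hp hvL hv hel hreg with h | ⟨h, hn1⟩ | ⟨h, hn1⟩
  · exact Or.inl (latticeCongruent_parallelepiped hv e.linearIndependent h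
      (sum_edges₁_mem_iff e) hp)
  · exact Or.inr (Or.inl ⟨latticeCongruent_parallelepiped hv (linearIndependent_edges₂ hn e) h
      (sum_edges₂_mem_iff hn e) hp, hn1⟩)
  -- In the plane the even-weight case is absorbed by the second model.
  · by_cases hn2 : n = 2
    · subst hn2
      refine Or.inr (Or.inl ⟨latticeCongruent_parallelepiped hv (linearIndependent_edges₂ hn e)
        (fun x => (h x).trans (isBodyCentered_iff_isHalfEven x).symm)
        (sum_edges₂_mem_iff hn e) hp, hn1⟩)
    exact Or.inr (Or.inr ⟨latticeCongruent_parallelepiped hv (linearIndependent_edges₃ hn e) h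
      (sum_edges₃_mem_iff hn e) hp, by omega⟩)

theorem hasLatticeVolume_cube₁ (hn : n ≠ 0) (e : Module.Basis (Fin n) ℝ 𝔼) :
    HasLatticeVolume (lattice e) (cube₁ e) n.factorial := by
  simpa [cube₁, e.det_self] using hasLatticeVolume_parallelepiped hn e e.linearIndependent 0

theorem hasLatticeVolume_cube₂ (hn : n ≠ 0) (e : Module.Basis (Fin n) ℝ 𝔼) :
    HasLatticeVolume (lattice e) (cube₂ e) (2 * n.factorial) := by
  have h := hasLatticeVolume_parallelepiped hn e (linearIndependent_edges₂ hn e) 0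
  rwa [zero_vadd, det_edges₂ hn, abs_two] at h

theorem hasLatticeVolume_cube₃ (hn : n ≠ 0) (e : Module.Basis (Fin n) ℝ 𝔼) :
    HasLatticeVolume (lattice e) (cube₃ e) (2 ^ (n - 1) * n.factorial) := by
  have h := hasLatticeVolume_parallelepiped hn e (linearIndependent_edges₃ hn e) 0
  rwa [zero_vadd, det_edges₃ hn, abs_of_pos (by positivity)] at h

end Models

end LatticeGeometry

/-! ### Assembly by dimension. -/

theorem mainTheorem4 (n : ℕ) (e : Module.Basis (Fin n) ℝ (EuclideanSpace ℝ (Fin n))) :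
    (n = 1 →
      ∀ C : Set (EuclideanSpace ℝ (Fin n)), IsLatticeCube (lattice e) C →
        IsElementary (lattice e) C → IsLatticeRegular (lattice e) C →
        (∃ A ∈ lattice e, ∃ B ∈ lattice e, C = segment ℝ A B) ∧
          HasLatticeVolume (lattice e) C 1) ∧
    (n = 2 →
      (∀ C : Set (EuclideanSpace ℝ (Fin n)), IsLatticeCube (lattice e) C →
        IsElementary (lattice e) C → IsLatticeRegular (lattice e) C →
        LatticeCongruent (lattice e) C (cube₁ e) ∨ LatticeCongruent (lattice e) C (cube₂ e)) ∧
      IsLatticeRegular (lattice e) (cube₁ e) ∧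
      IsLatticeRegular (lattice e) (cube₂ e) ∧
      ¬ LatticeCongruent (lattice e) (cube₁ e) (cube₂ e)) ∧
    (3 ≤ n →
      (∀ C : Set (EuclideanSpace ℝ (Fin n)), IsLatticeCube (lattice e) C →
        IsElementary (lattice e) C → IsLatticeRegular (lattice e) C →
        LatticeCongruent (lattice e) C (cube₁ e) ∨ LatticeCongruent (lattice e) C (cube₂ e) ∨
          LatticeCongruent (lattice e) C (cube₃ e)) ∧
      IsLatticeRegular (lattice e) (cube₁ e) ∧
      IsLatticeRegular (lattice e) (cube₂ e) ∧
      IsLatticeRegular (lattice e) (cube₃ e) ∧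
      ¬ LatticeCongruent (lattice e) (cube₁ e) (cube₂ e) ∧
      ¬ LatticeCongruent (lattice e) (cube₁ e) (cube₃ e) ∧
      ¬ LatticeCongruent (lattice e) (cube₂ e) (cube₃ e) ∧
      HasLatticeVolume (lattice e) (cube₁ e) (n.factorial : ℝ) ∧
      HasLatticeVolume (lattice e) (cube₂ e) (2 * (n.factorial : ℝ)) ∧
      HasLatticeVolume (lattice e) (cube₃ e) (2 ^ (n - 1) * (n.factorial : ℝ))) := by
  refine ⟨?_, ?_, ?_⟩
  · rintro rfl C hC hel hreg
    have hcong : LatticeCongruent (lattice e) C (cube₁ e) := by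
      rcases latticeCongruent_of_isElementary one_ne_zero e hC hel hreg with h | ⟨-, h⟩ | ⟨-, h⟩
      · exact h
      · exact absurd rfl h
      · omega
    constructor
    · obtain ⟨p, hp, v, hvL, -, rfl⟩ := hC
      refine ⟨p, hp, p + v 0, add_mem hp (hvL 0), ?_⟩
      rw [parallelepiped_eq_sum_segment, Fin.sum_univ_one, vadd_segment, vadd_eq_add, vadd_eq_add,
        add_zero]
    -- The length is that of the congruent first model, namely `1! = 1`.
    · obtain ⟨V₀, hV₀, h⟩ := hasLatticeVolume_cube₁ one_ne_zero e
      refine ⟨V₀, hV₀, ?_⟩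
      rw [volume_real_eq_of_latticeCongruent e hcong, h]
      simp
  · rintro rfl
    refine ⟨fun C hC hel hreg => ?_, isLatticeRegular_cube₁ e,
      isLatticeRegular_cube₂ two_ne_zero e, not_latticeCongruent_cube₁_cube₂ two_ne_zero e⟩
    rcases latticeCongruent_of_isElementary two_ne_zero e hC hel hreg with h | ⟨h, -⟩ | ⟨-, h⟩
    · exact Or.inl h
    · exact Or.inr h
    · omega
  · intro hn
    have hn0 : n ≠ 0 := by omega
    exact ⟨fun C hC hel hreg => (latticeCongruent_of_isElementary hn0 e hC hel hreg).imp_right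
        (Or.imp And.left And.left),
      isLatticeRegular_cube₁ e, isLatticeRegular_cube₂ hn0 e, isLatticeRegular_cube₃ hn0 e,
      not_latticeCongruent_cube₁_cube₂ hn0 e, not_latticeCongruent_cube₁_cube₃ (by omega) e,
      not_latticeCongruent_cube₂_cube₃ hn e, hasLatticeVolume_cube₁ hn0 e,
      hasLatticeVolume_cube₂ hn0 e, hasLatticeVolume_cube₃ hn0 e⟩
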